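/- Let $k$ be a commutative Artinian ring and let $R$ be an Artin $k$-algebra, that is, a $k$-algebra which is finitely generated as a $k$-module. Let $\operatorname{Mod} R$ be the category of left $R$-modules and $\operatorname{mod} R$ the full subcategory of finitely generated ones. For $M\in\operatorname{Mod} R$ let $0\to M\to E^0(M)\to E^1(M)\to\cdots$ be a minimal injective coresolution of $M$. For $s\ge 0$ let $\mathscr{G}_\infty(s)$ be the class of all $M\in\operatorname{Mod} R$ such that the flat dimension of $E^i(M)$ is at most $s+i$ for every $i\ge 0$, and let $\mathscr{P}^s(\operatorname{Mod} R)$ (resp. $\mathscr{P}^s(\operatorname{mod} R)$) be the class of all modules in $\operatorname{Mod} R$ (resp. $\operatorname{mod} R$) of projective dimension at most $s$; in particular $\mathscr{P}^0$ is the class of projective modules. A left and right Noetherian ring is called Auslander-regular if ${}_RR\in\mathscr{G}_\infty(0)$ (the Auslander condition) and its global dimension is finite. Then the following statements are equivalent. (1) $R$ is Auslander-regular. (2) $\mathscr{G}_\infty(0)=\mathscr{P}^0(\operatorname{Mod} R)$. (3) $\mathscr{G}_\infty(0)\cap\operatorname{mod} R=\mathscr{P}^0(\operatorname{mod} R)$.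 (4) $\mathscr{G}_\infty(s)=\mathscr{P}^s(\operatorname{Mod} R)$ for every $s\ge 0$. (5) $\mathscr{G}_\infty(s)\cap\operatorname{mod} R=\mathscr{P}^s(\operatorname{mod} R)$ for every $s\ge 0$. -/

import Mathlib

open CategoryTheory
open scoped TensorProduct MulOpposite

universe u v

noncomputable section

namespace AuslanderType

/-! ### Flat modules over a noncommutative ring

Mathlib's `Module.Flat` is restricted to commutative rings. Right `R`-modules are
`Rᵐᵒᵖ`-modules, with `n r = op r • n`. -/

section Flat

variable (R : Type u) [Ring R]

/-- The subgroup of `N ⊗[ℤ] M` generated by all `(n r) ⊗ m - n ⊗ (r m)`. -/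
def balancingRelations (N M : Type u) [AddCommGroup N] [Module Rᵐᵒᵖ N]
    [AddCommGroup M] [Module R M] : AddSubgroup (N ⊗[ℤ] M) :=
  AddSubgroup.closure
    {x | ∃ (n : N) (r : R) (m : M), x = (MulOpposite.op r • n) ⊗ₜ[ℤ] m - n ⊗ₜ[ℤ] (r • m)}

/-- The tensor product `N ⊗_R M` of a right `R`-module `N` and a left `R`-module `M`. -/
abbrev BalancedTensor (N M : Type u) [AddCommGroup N] [Module Rᵐᵒᵖ N]
    [AddCommGroup M] [Module R M] : Type u :=
  (N ⊗[ℤ] M) ⧸ balancingRelations R N M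

variable {R} in
theorem balancingRelations_le_comap {N N' : Type u} (M : Type u)
    [AddCommGroup N] [Module Rᵐᵒᵖ N] [AddCommGroup N'] [Module Rᵐᵒᵖ N']
    [AddCommGroup M] [Module R M] (f : N →ₗ[Rᵐᵒᵖ] N') :
    balancingRelations R N M ≤
      (balancingRelations R N' M).comap
        (LinearMap.rTensor M (f.restrictScalars ℤ)).toAddMonoidHom := by
  refine (AddSubgroup.closure_le _).2 ?_
  rintro _ ⟨n, r, m, rfl⟩
  refine AddSubgroup.subset_closure ⟨f n, r, m, ?_⟩
  simp

variable {R} in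
/-- The map `f ⊗_R M : N ⊗_R M → N' ⊗_R M` induced by a map `f : N → N'` of right modules. -/
def BalancedTensor.map {N N' : Type u} (M : Type u)
    [AddCommGroup N] [Module Rᵐᵒᵖ N] [AddCommGroup N'] [Module Rᵐᵒᵖ N']
    [AddCommGroup M] [Module R M] (f : N →ₗ[Rᵐᵒᵖ] N') :
    BalancedTensor R N M →+ BalancedTensor R N' M :=
  QuotientAddGroup.map _ _ (LinearMap.rTensor M (f.restrictScalars ℤ)).toAddMonoidHom
    (balancingRelations_le_comap M f)

/-- A left `R`-module `M` is flat if `- ⊗_R M` preserves injectivity of maps of right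
`R`-modules. -/
def IsFlat (M : Type u) [AddCommGroup M] [Module R M] : Prop :=
  ∀ ⦃N N' : Type u⦄ [AddCommGroup N] [Module Rᵐᵒᵖ N] [AddCommGroup N'] [Module Rᵐᵒᵖ N']
    (f : N →ₗ[Rᵐᵒᵖ] N'), Function.Injective f → Function.Injective (BalancedTensor.map M f)

end Flat

section Classes

variable (R : Type u) [Ring R]

/-- `FlatDimLE R n M`: the flat dimension of `M` is at most `n`, that is, there is an exact
sequence `0 → Fₙ → ⋯ → F₁ → F₀ → M → 0` with all `Fᵢ` flat; it is spliced here from short exact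
sequences `0 → ker p → F → M → 0`. -/
def FlatDimLE : ℕ → ModuleCat.{u} R → Prop
  | 0, M => IsFlat R M
  | n + 1, M => ∃ (F : ModuleCat.{u} R) (p : F →ₗ[R] M),
      IsFlat R F ∧ Function.Surjective p ∧ FlatDimLE n (ModuleCat.of R (LinearMap.ker p))

variable {R} in
/-- A submodule is essential if it meets every nonzero submodule nontrivially. -/
def IsEssential {E : Type u} [AddCommGroup E] [Module R E] (K : Submodule R E) : Prop :=
  ∀ L : Submodule R E, L ⊓ K = ⊥ → L = ⊥

variable {R} in
/-- A minimal injective coresolution `0 → M → E⁰ → E¹ → ⋯` of `M`: an exact sequence with all `Eⁱ`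
injective, in which `E⁰` is an injective envelope of `M` and `Eⁱ⁺¹` is an injective envelope of
the image of `Eⁱ → Eⁱ⁺¹`. -/
structure MinimalInjectiveCoresolution (M : ModuleCat.{u} R) where
  /-- the terms -/
  E : ℕ → ModuleCat.{u} R
  /-- the coaugmentation -/
  ι : M →ₗ[R] E 0
  /-- the differentials -/
  d : ∀ i : ℕ, E i →ₗ[R] E (i + 1)
  injective : ∀ i, Module.Injective R (E i)
  ι_injective : Function.Injective ι
  exact_zero : Function.Exact ι (d 0)
  exact_succ : ∀ i, Function.Exact (d i) (d (i + 1))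
  essential_zero : IsEssential (LinearMap.range ι)
  essential_succ : ∀ i, IsEssential (LinearMap.range (d i))

/-- The full subcategory `𝒢ₙ(m)` of `Mod R`: the modules `M` with `fd Eⁱ(M) ≤ m + i` for all
`0 ≤ i ≤ n - 1`, where `E•(M)` is a minimal injective coresolution of `M`. -/
def gClass (n m : ℕ) : ObjectProperty (ModuleCat.{u} R) := fun M =>
  ∃ C : MinimalInjectiveCoresolution M, ∀ i < n, FlatDimLE R (m + i) (C.E i)

/-- The full subcategory `𝒢_∞(m) = ⋂ₙ 𝒢ₙ(m)` of `Mod R`. -/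
def gInftyClass (m : ℕ) : ObjectProperty (ModuleCat.{u} R) := fun M =>
  ∀ n : ℕ, gClass R n m M

/-- The full subcategory `𝒫ˢ(Mod R)` of modules of projective dimension at most `s`. -/
def projDimLEClass (s : ℕ) : ObjectProperty (ModuleCat.{u} R) := fun M =>
  projectiveDimension M ≤ s

/-- The left global dimension: the supremum of the projective dimensions of all left modules. -/
def globalDimension : WithBot ℕ∞ :=
  ⨆ M : ModuleCat.{u} R, projectiveDimension M

/-- `R` satisfies the Auslander condition: `fd Eⁱ(R) ≤ i` for all `i`, for the left module `R`. -/
def AuslanderCondition : Prop :=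
  gInftyClass R 0 (ModuleCat.of R R)

/-- A left and right Noetherian ring is Auslander-regular if it satisfies the Auslander condition
and has finite global dimension. -/
structure IsAuslanderRegular : Prop where
  noetherian_left : IsNoetherianRing R
  noetherian_right : IsNoetherianRing Rᵐᵒᵖ
  auslander : AuslanderCondition R
  gldim_lt_top : globalDimension R < ⊤

end Classes

end AuslanderType

end

namespace AuslanderType

/-! ### Short exact sequences and homological dimensions of unbundled modules -/

section Dimension

variable {R : Type u} [Ring R]

/-! Over an Artin algebra flat modules are projective (`IsFlat.projective`), so flat dimensions are
projective dimensions. An injective envelope splits off from any other injective embedding, so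
minimality of coresolutions can be dropped (`gInftyClass_iff`). Thus 𝒢_∞(s) is described by `CoresLE
R n s` for all n, a condition that behaves well in short exact sequences.

If R is Auslander-regular, pd M ≤ s puts M in 𝒢_∞(s) (`CoresLE.of_pdLE`), and finite global
dimension allows the way back along a coresolution (`CoresLE.pdLE`).

The substance is (3) ⟹ (1). Applied to R itself, (3) gives the Auslander condition; finite global
dimension remains. The Auslander condition first yields its dual (`coverIdLE`) and embeddings uᵢ : R
→ Yᵢ with Yᵢ projective of injective dimension at most i and well coresolved cokernel. As R is right
Noetherian, finitely many coordinates of the uᵢ(1) define a map h : R → Rᵗ through which every uᵢ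
factors. Then coker h lies in 𝒢_∞(0), so it is projective by (3), h splits, and R is a summand of a
finite product of Yᵢ: its injective dimension is finite (`exists_idLE_self`).

Next comes a count in ℚ^ι, with ι indexing the simple modules. Finite self-injective dimension makes
the classes of projectives combinations of Euler vectors of those envelopes of simples that have
finite projective dimension. Projectives span ℚ^ι, so no envelope can be missing
(`SimpleFamily.exists_pdLE_envelope`). Hence some D bounds the projective dimension of all finitely
generated injectives, every finitely generated module lies in 𝒢_∞(D), and (3) with dimension
shifting gives it projective dimension at most D. Applied to R/J, this bounds the global dimension.
-/

/-- `0 → A → B → C → 0` is a short exact sequence. -/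
structure IsSES {A B C : Type u} [AddCommGroup A] [Module R A] [AddCommGroup B] [Module R B]
    [AddCommGroup C] [Module R C] (f : A →ₗ[R] B) (g : B →ₗ[R] C) : Prop where
  inj : Function.Injective f
  surj : Function.Surjective g
  exact : Function.Exact f g

variable (R) in
/-- The projective dimension of `M` is at most `n`. -/
def PdLE (n : ℕ) (M : Type u) [AddCommGroup M] [Module R M] : Prop :=
  HasProjectiveDimensionLE (ModuleCat.of R M) n

variable (R) in
/-- The injective dimension of `M` is at most `n`. -/
def IdLE (n : ℕ) (M : Type u) [AddCommGroup M] [Module R M] : Prop :=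
  HasInjectiveDimensionLE (ModuleCat.of R M) n

variable {A B C M N P : Type u} [AddCommGroup A] [Module R A] [AddCommGroup B] [Module R B]
  [AddCommGroup C] [Module R C] [AddCommGroup M] [Module R M] [AddCommGroup N] [Module R N]
  [AddCommGroup P] [Module R P]

theorem isSES_mkQ (K : Submodule R M) : IsSES K.subtype K.mkQ :=
  ⟨K.injective_subtype, K.mkQ_surjective, LinearMap.exact_subtype_mkQ K⟩

theorem isSES_ker {g : M →ₗ[R] N} (hg : Function.Surjective g) :
    IsSES (LinearMap.ker g).subtype g :=
  ⟨Submodule.injective_subtype _, hg, LinearMap.exact_subtype_ker_map g⟩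

theorem isSES_range {f : M →ₗ[R] N} (hf : Function.Injective f) :
    IsSES f (LinearMap.range f).mkQ :=
  ⟨hf, Submodule.mkQ_surjective _, LinearMap.exact_map_mkQ_range f⟩

theorem isSES_prod : IsSES (LinearMap.inl R M N) (LinearMap.snd R M N) :=
  ⟨LinearMap.inl_injective, LinearMap.snd_surjective, .inl_snd⟩

theorem isSES_prod' : IsSES (LinearMap.inr R M N) (LinearMap.fst R M N) :=
  ⟨LinearMap.inr_injective, LinearMap.fst_surjective, .inr_fst⟩

namespace IsSES

variable {f : A →ₗ[R] B} {g : B →ₗ[R] C}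

theorem apply_apply_eq_zero (h : IsSES f g) (a : A) : g (f a) = 0 :=
  h.exact.apply_apply_eq_zero a

theorem comp_equiv (h : IsSES f g) (e : M ≃ₗ[R] A) : IsSES (f ∘ₗ e.toLinearMap) g := by
  refine ⟨h.inj.comp e.injective, h.surj, fun b ↦ ?_⟩
  rw [h.exact b]
  constructor
  · rintro ⟨a, rfl⟩
    exact ⟨e.symm a, by simp⟩
  · rintro ⟨m, rfl⟩
    exact ⟨e m, rfl⟩

theorem equiv_comp (h : IsSES f g) (e : C ≃ₗ[R] M) : IsSES f (e.toLinearMap ∘ₗ g) := by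
  refine ⟨h.inj, e.surjective.comp h.surj, fun b ↦ ?_⟩
  rw [← h.exact b]
  simp

/-- The map from the cokernel term induced by a map that vanishes on the image of `f`. -/
noncomputable def desc (h : IsSES f g) (φ : B →ₗ[R] M) (hφ : φ ∘ₗ f = 0) : C →ₗ[R] M :=
  (LinearMap.ker g).liftQ φ (fun b hb ↦ by
    obtain ⟨a, rfl⟩ := (h.exact b).1 hb
    exact LinearMap.congr_fun hφ a) ∘ₗ (g.quotKerEquivOfSurjective h.surj).symm.toLinearMap

theorem desc_apply (h : IsSES f g) (φ : B →ₗ[R] M) (hφ : φ ∘ₗ f = 0) (b : B) :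
    h.desc φ hφ (g b) = φ b := by
  have : (g.quotKerEquivOfSurjective h.surj).symm (g b) = Submodule.Quotient.mk b := by
    rw [LinearEquiv.symm_apply_eq]
    rfl
  simp [desc, this]

/-- The map to the kernel term induced by a map whose image `g` kills. -/
noncomputable def lift (h : IsSES f g) (φ : M →ₗ[R] B) (hφ : g ∘ₗ φ = 0) : M →ₗ[R] A :=
  (LinearEquiv.ofInjective f h.inj).symm.toLinearMap ∘ₗ
    φ.codRestrict (LinearMap.range f) fun m ↦ (h.exact _).1 (LinearMap.congr_fun hφ m)

theorem apply_lift (h : IsSES f g) (φ : M →ₗ[R] B) (hφ : g ∘ₗ φ = 0) (m : M) :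
    f (h.lift φ hφ m) = φ m :=
  congrArg Subtype.val ((LinearEquiv.ofInjective f h.inj).apply_symm_apply
    ⟨φ m, (h.exact _).1 (LinearMap.congr_fun hφ m)⟩)

/-- A short exact sequence as a short complex in the category of modules. -/
abbrev toShortComplex (h : IsSES f g) : ShortComplex (ModuleCat.{u} R) :=
  ShortComplex.moduleCatMk f g (LinearMap.ext h.apply_apply_eq_zero)

theorem shortExact (h : IsSES f g) : h.toShortComplex.ShortExact where
  exact := (ShortComplex.ShortExact.moduleCat_exact_iff_function_exact _).2 h.exact
  mono_f := (ModuleCat.mono_iff_injective _).2 h.inj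
  epi_g := (ModuleCat.epi_iff_surjective _).2 h.surj

theorem pdLE_left (h : IsSES f g) {n : ℕ} (hB : PdLE R n B) (hC : PdLE R (n + 1) C) :
    PdLE R n A :=
  h.shortExact.hasProjectiveDimensionLT_X₁ (n + 1) hB hC

theorem pdLE_middle (h : IsSES f g) {n : ℕ} (hA : PdLE R n A) (hC : PdLE R n C) :
    PdLE R n B :=
  h.shortExact.hasProjectiveDimensionLT_X₂ (n + 1) hA hC

theorem pdLE_right (h : IsSES f g) {n : ℕ} (hA : PdLE R n A) (hB : PdLE R (n + 1) B) :
    PdLE R (n + 1) C :=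
  h.shortExact.hasProjectiveDimensionLT_X₃ (n + 1) hA hB

theorem idLE_left (h : IsSES f g) {n : ℕ} (hB : IdLE R (n + 1) B) (hC : IdLE R n C) :
    IdLE R (n + 1) A :=
  h.shortExact.hasInjectiveDimensionLT_X₁ (n + 1) hC hB

theorem idLE_middle (h : IsSES f g) {n : ℕ} (hA : IdLE R n A) (hC : IdLE R n C) :
    IdLE R n B :=
  h.shortExact.hasInjectiveDimensionLT_X₂ (n + 1) hA hC

theorem idLE_right (h : IsSES f g) {n : ℕ} (hA : IdLE R (n + 1) A) (hB : IdLE R n B) :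
    IdLE R n C :=
  h.shortExact.hasInjectiveDimensionLT_X₃ (n + 1) hB hA

/-- Vanishing of `Ext¹(C, K)` lets maps to `K` extend from `A` to `B`. -/
theorem exists_extension (h : IsSES f g)
    (hext : ∀ x : Abelian.Ext (ModuleCat.of R C) (ModuleCat.of R M) 1, x = 0) (φ : A →ₗ[R] M) :
    ∃ ψ : B →ₗ[R] M, ψ ∘ₗ f = φ := by
  obtain ⟨x, hx⟩ := Abelian.Ext.contravariant_sequence_exact₁ h.shortExact (ModuleCat.of R M)
    (Abelian.Ext.mk₀ (ModuleCat.ofHom φ)) (add_zero 1) (hext _)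
  obtain ⟨ψ, rfl⟩ := Abelian.Ext.homEquiv₀.symm.surjective x
  have : ModuleCat.ofHom f ≫ ψ = ModuleCat.ofHom φ :=
    Abelian.Ext.homEquiv₀.symm.injective ((Abelian.Ext.mk₀_comp_mk₀ _ _).symm.trans hx)
  exact ⟨ψ.hom, congrArg ModuleCat.Hom.hom this⟩

/-- The connecting map `Ext^{n+1}(A, M) → Ext^{n+2}(C, M)` is injective because `Ext^{n+1}(B, M)`
vanishes for projective `B`. -/
theorem ext_eq_zero (h : IsSES f g) (hB : Module.Projective R B) (n : ℕ)
    (hext : ∀ x : Abelian.Ext (ModuleCat.of R C) (ModuleCat.of R M) (n + 2), x = 0)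
    (x : Abelian.Ext (ModuleCat.of R A) (ModuleCat.of R M) (n + 1)) : x = 0 := by
  have : Projective h.toShortComplex.X₂ := (IsProjective.iff_projective B).1 hB
  obtain ⟨y, rfl⟩ := Abelian.Ext.contravariant_sequence_exact₁ h.shortExact (ModuleCat.of R M)
    x (by omega : 1 + (n + 1) = n + 2) (hext _)
  rw [y.eq_zero_of_projective, Abelian.Ext.comp_zero]
  rfl

end IsSES

theorem pdLE_zero_iff : PdLE R 0 M ↔ Module.Projective R M :=
  projective_iff_hasProjectiveDimensionLT_one.symm.trans (IsProjective.iff_projective M).symm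

theorem idLE_zero_iff : IdLE R 0 M ↔ Module.Injective R M :=
  injective_iff_hasInjectiveDimensionLT_one.symm.trans
    (Module.injective_iff_injective_object R M).symm

theorem PdLE.mono {m n : ℕ} (h : PdLE R m M) (hmn : m ≤ n) : PdLE R n M := by
  have : HasProjectiveDimensionLT (ModuleCat.of R M) (m + 1) := h
  exact hasProjectiveDimensionLT_of_ge _ (m + 1) (n + 1) (by omega)

theorem IdLE.mono {m n : ℕ} (h : IdLE R m M) (hmn : m ≤ n) : IdLE R n M := by
  have : HasInjectiveDimensionLT (ModuleCat.of R M) (m + 1) := h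
  exact hasInjectiveDimensionLT_of_ge _ (m + 1) (n + 1) (by omega)

/-- A retraction of modules, as a retract in the category of modules. -/
def retractOfLeftInverse (i : M →ₗ[R] N) (r : N →ₗ[R] M) (h : r ∘ₗ i = LinearMap.id) :
    Retract (ModuleCat.of R M) (ModuleCat.of R N) where
  i := ModuleCat.ofHom i
  r := ModuleCat.ofHom r
  retract := by rw [← ModuleCat.ofHom_comp, h, ModuleCat.ofHom_id]

theorem PdLE.retract {n : ℕ} (hN : PdLE R n N) (i : M →ₗ[R] N) (r : N →ₗ[R] M)
    (h : r ∘ₗ i = LinearMap.id) : PdLE R n M :=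
  have : HasProjectiveDimensionLT (ModuleCat.of R N) (n + 1) := hN
  (retractOfLeftInverse i r h).hasProjectiveDimensionLT (n + 1)

theorem IdLE.retract {n : ℕ} (hN : IdLE R n N) (i : M →ₗ[R] N) (r : N →ₗ[R] M)
    (h : r ∘ₗ i = LinearMap.id) : IdLE R n M :=
  have : HasInjectiveDimensionLT (ModuleCat.of R N) (n + 1) := hN
  (retractOfLeftInverse i r h).hasInjectiveDimensionLT (n + 1)

theorem PdLE.prod {n : ℕ} (hM : PdLE R n M) (hN : PdLE R n N) : PdLE R n (M × N) :=
  isSES_prod.pdLE_middle hM hN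

theorem IdLE.prod {n : ℕ} (hM : IdLE R n M) (hN : IdLE R n N) : IdLE R n (M × N) :=
  isSES_prod.idLE_middle hM hN

theorem pdLE_of_projective [h : Module.Projective R M] (n : ℕ) : PdLE R n M :=
  (pdLE_zero_iff.2 h).mono (Nat.zero_le n)

theorem idLE_of_injective (h : Module.Injective R M) (n : ℕ) : IdLE R n M :=
  (idLE_zero_iff.2 h).mono (Nat.zero_le n)

theorem pdLE_of_subsingleton [Subsingleton M] (n : ℕ) : PdLE R n M :=
  have : Module.Projective R M := inferInstance
  pdLE_of_projective n

theorem injective_of_retract (hN : Module.Injective R N) (i : M →ₗ[R] N) (r : N →ₗ[R] M)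
    (h : r ∘ₗ i = LinearMap.id) : Module.Injective R M :=
  idLE_zero_iff.1 ((idLE_zero_iff.2 hN).retract i r h)

theorem injective_prod (hM : Module.Injective R M) (hN : Module.Injective R N) :
    Module.Injective R (M × N) :=
  idLE_zero_iff.1 ((idLE_zero_iff.2 hM).prod (idLE_zero_iff.2 hN))

/-- Extension of maps into an injective module along an injective map. -/
theorem exists_extension_of_injective (hM : Module.Injective R M) {f : A →ₗ[R] B}
    (hf : Function.Injective f) (φ : A →ₗ[R] M) : ∃ ψ : B →ₗ[R] M, ψ ∘ₗ f = φ := by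
  obtain ⟨ψ, hψ⟩ := hM.out f hf φ
  exact ⟨ψ, LinearMap.ext hψ⟩

theorem IsSES.exists_section {f : A →ₗ[R] B} {g : B →ₗ[R] C} (h : IsSES f g)
    [Module.Projective R C] : ∃ s : C →ₗ[R] B, g ∘ₗ s = LinearMap.id :=
  Module.projective_lifting_property g LinearMap.id h.surj

/-- A splitting of a short exact sequence given by a section. -/
noncomputable def IsSES.prodEquivOfSection {f : A →ₗ[R] B} {g : B →ₗ[R] C} (h : IsSES f g)
    (s : C →ₗ[R] B) (hs : g ∘ₗ s = LinearMap.id) : (A × C) ≃ₗ[R] B :=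
  LinearEquiv.ofBijective (f.coprod s) <| by
    have hs' : ∀ c, g (s c) = c := LinearMap.congr_fun hs
    constructor
    · rw [injective_iff_map_eq_zero]
      rintro ⟨a, c⟩ hac
      have hac' : f a + s c = 0 := by simpa using hac
      have hc : c = 0 := by
        simpa [h.apply_apply_eq_zero, hs'] using congrArg g hac'
      subst hc
      have ha : a = 0 := h.inj (by simpa using hac')
      simp [ha]
    · intro b
      obtain ⟨a, ha⟩ := (h.exact (b - s (g b))).1 (by simp [hs'])
      exact ⟨(a, g b), by simp [ha]⟩

theorem IsSES.nonempty_prodEquiv {f : A →ₗ[R] B} {g : B →ₗ[R] C} (h : IsSES f g)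
    [Module.Projective R C] : Nonempty ((A × C) ≃ₗ[R] B) := by
  obtain ⟨s, hs⟩ := h.exists_section
  exact ⟨h.prodEquivOfSection s hs⟩

theorem IsSES.nonempty_prodEquiv_of_retraction {f : A →ₗ[R] B} {g : B →ₗ[R] C} (h : IsSES f g)
    (r : B →ₗ[R] A) (hr : r ∘ₗ f = LinearMap.id) : Nonempty ((A × C) ≃ₗ[R] B) := by
  have hr' : ∀ a, r (f a) = a := LinearMap.congr_fun hr
  refine ⟨(LinearEquiv.ofBijective (r.prod g) ⟨?_, ?_⟩).symm⟩
  · rw [injective_iff_map_eq_zero]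
    intro b hb
    obtain ⟨h1, h2⟩ : r b = 0 ∧ g b = 0 := by simpa using hb
    obtain ⟨a, rfl⟩ := (h.exact b).1 h2
    rw [hr'] at h1
    simp [h1]
  · rintro ⟨a, c⟩
    obtain ⟨b, rfl⟩ := h.surj c
    exact ⟨b + f (a - r b), by simp [hr', h.apply_apply_eq_zero]⟩

theorem IsSES.nonempty_prodEquiv_of_injective {f : A →ₗ[R] B} {g : B →ₗ[R] C} (h : IsSES f g)
    (hA : Module.Injective R A) : Nonempty ((A × C) ≃ₗ[R] B) := by
  obtain ⟨r, hr⟩ := exists_extension_of_injective hA h.inj LinearMap.id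
  exact h.nonempty_prodEquiv_of_retraction r hr

theorem PdLE.of_prodEquiv_left {n : ℕ} (hB : PdLE R n B) (e : (A × C) ≃ₗ[R] B) : PdLE R n A :=
  hB.retract (e.toLinearMap ∘ₗ LinearMap.inl R A C) (LinearMap.fst R A C ∘ₗ e.symm.toLinearMap)
    (by ext; simp)

theorem PdLE.of_prodEquiv_right {n : ℕ} (hB : PdLE R n B) (e : (A × C) ≃ₗ[R] B) : PdLE R n C :=
  hB.retract (e.toLinearMap ∘ₗ LinearMap.inr R A C) (LinearMap.snd R A C ∘ₗ e.symm.toLinearMap)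
    (by ext; simp)

theorem injective_of_prodEquiv_right (hB : Module.Injective R B) (e : (A × C) ≃ₗ[R] B) :
    Module.Injective R C :=
  injective_of_retract hB (e.toLinearMap ∘ₗ LinearMap.inr R A C)
    (LinearMap.snd R A C ∘ₗ e.symm.toLinearMap) (by ext; simp)

theorem IsSES.exists_retraction {f : A →ₗ[R] B} {g : B →ₗ[R] C} (h : IsSES f g)
    [Module.Projective R C] : ∃ r : B →ₗ[R] A, r ∘ₗ f = LinearMap.id := by
  obtain ⟨s, hs⟩ := h.exists_section
  let e := h.prodEquivOfSection s hs
  refine ⟨LinearMap.fst R A C ∘ₗ e.symm.toLinearMap, LinearMap.ext fun a ↦ ?_⟩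
  have : e.symm (f a) = (a, 0) := by
    rw [LinearEquiv.symm_apply_eq]
    change f a = f a + s 0
    simp
  simp [this]

/-- The horseshoe lemma, one step. -/
theorem IsSES.horseshoe {α : A →ₗ[R] B} {β : B →ₗ[R] C} (h : IsSES α β)
    {K F K' F' : Type u} [AddCommGroup K] [Module R K] [AddCommGroup F] [Module R F]
    [AddCommGroup K'] [Module R K'] [AddCommGroup F'] [Module R F'] [Module.Projective R F']
    {i : K →ₗ[R] F} {p : F →ₗ[R] A} {i' : K' →ₗ[R] F'} {p' : F' →ₗ[R] C}
    (hA : IsSES i p) (hC : IsSES i' p') :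
    ∃ (π : F × F' →ₗ[R] B) (φ : K →ₗ[R] LinearMap.ker π) (ψ : LinearMap.ker π →ₗ[R] K'),
      Function.Surjective π ∧ IsSES φ ψ := by
  obtain ⟨σ, hσ'⟩ := Module.projective_lifting_property β p' h.surj
  have hσ (y) : β (σ y) = p' y := LinearMap.congr_fun hσ' y
  let π : F × F' →ₗ[R] B := (α ∘ₗ p).coprod σ
  have hπ (x y) : π (x, y) = α (p x) + σ y := rfl
  have hβ (z) : β (π z) = p' z.2 := by
    rw [← Prod.mk.eta (p := z), hπ, map_add, h.apply_apply_eq_zero, zero_add, hσ]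
  let φ : K →ₗ[R] LinearMap.ker π := (LinearMap.inl R F F' ∘ₗ i).codRestrict _ fun k ↦ by
    simp [hπ, hA.apply_apply_eq_zero]
  have hφ (k) : (φ k : F × F') = (i k, 0) := rfl
  let ψ : LinearMap.ker π →ₗ[R] K' :=
    hC.lift (LinearMap.snd R F F' ∘ₗ (LinearMap.ker π).subtype) (by
      ext z
      have := hβ z
      rw [LinearMap.mem_ker.1 z.2, map_zero] at this
      exact this.symm)
  have hψ (z) : i' (ψ z) = (z : F × F').2 := hC.apply_lift _ _ _
  refine ⟨π, φ, ψ, fun b ↦ ?_, fun k k' hk ↦ hA.inj ?_, fun k' ↦ ?_, fun z ↦ ⟨fun hz ↦ ?_, ?_⟩⟩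
  · obtain ⟨y, hy⟩ := hC.surj (β b)
    obtain ⟨a, ha⟩ := (h.exact (b - σ y)).1 (by rw [map_sub, hσ, hy, sub_self])
    obtain ⟨x, rfl⟩ := hA.surj a
    exact ⟨(x, y), by rw [hπ, ha, sub_add_cancel]⟩
  · exact congrArg (fun z : LinearMap.ker π ↦ (z : F × F').1) hk
  · have h1 : β (σ (i' k')) = 0 := by rw [hσ, hC.apply_apply_eq_zero]
    obtain ⟨a, ha⟩ := (h.exact _).1 h1
    obtain ⟨x, rfl⟩ := hA.surj a
    refine ⟨⟨(-x, i' k'), ?_⟩, hC.inj (hψ _)⟩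
    rw [LinearMap.mem_ker, hπ, map_neg, map_neg, ha, neg_add_cancel]
  · have h2 : (z : F × F').2 = 0 := by rw [← hψ, hz, map_zero]
    have h3 : α (p (z : F × F').1) = 0 := by
      have := LinearMap.mem_ker.1 z.2
      rwa [← Prod.mk.eta (p := (z : F × F')), hπ, h2, map_zero, add_zero] at this
    obtain ⟨k, hk⟩ := (hA.exact _).1 (h.inj (h3.trans (map_zero α).symm))
    exact ⟨k, Subtype.ext (Prod.ext hk h2.symm)⟩
  · rintro ⟨k, rfl⟩
    exact hC.inj (by rw [hψ, hφ, map_zero])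

theorem isSES_finsupp (ι : Type u) {f : A →ₗ[R] B} {g : B →ₗ[R] C} (h : IsSES f g) :
    IsSES (Finsupp.mapRange.linearMap (α := ι) f) (Finsupp.mapRange.linearMap (α := ι) g) := by
  refine ⟨Finsupp.mapRange_injective f (map_zero f) h.inj,
    Finsupp.mapRange_surjective g (map_zero g) h.surj, fun b ↦ ⟨fun hb ↦ ?_, ?_⟩⟩
  · have hb' : ∀ i, ∃ a, f a = b i := fun i ↦ (h.exact (b i)).1 (by
      simpa using DFunLike.congr_fun hb i)
    choose a ha using hb'
    refine ⟨Finsupp.onFinset b.support a fun i hi ↦ ?_, ?_⟩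
    · rw [Finsupp.mem_support_iff]
      intro h0
      exact hi (h.inj (by rw [ha, h0, map_zero]))
    · ext i
      simp [ha]
  · rintro ⟨a, rfl⟩
    ext i
    simp [h.apply_apply_eq_zero]

/-- Dimension shifting along a free cover reduces to direct sums of projectives. -/
theorem PdLE.finsupp (ι : Type u) {n : ℕ} (hM : PdLE R n M) : PdLE R n (ι →₀ M) := by
  induction n generalizing M with
  | zero =>
    have := pdLE_zero_iff.1 hM
    classical
    have : Module.Projective R (ι →₀ M) :=
      .of_equiv' (finsuppLEquivDirectSum R M ι).symm
    exact pdLE_of_projective 0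
  | succ n ih =>
    have hs := isSES_ker (Finsupp.linearCombination_id_surjective R M)
    have hK := ih (hs.pdLE_left (pdLE_of_projective n) hM)
    exact (isSES_finsupp ι hs).pdLE_right hK (pdLE_of_projective _)

theorem IdLE.exists_isSES {n : ℕ} (hM : IdLE R (n + 1) M) :
    ∃ (E N : Type u) (_ : AddCommGroup E) (_ : Module R E) (_ : AddCommGroup N) (_ : Module R N)
      (f : M →ₗ[R] E) (g : E →ₗ[R] N), Module.Injective R E ∧ IsSES f g ∧ IdLE R n N := by
  let E : ModuleCat.{u} R := Injective.under (ModuleCat.of R M)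
  let j : M →ₗ[R] E := (Injective.ι (ModuleCat.of R M)).hom
  have hj : Function.Injective j := (ModuleCat.mono_iff_injective _).1 inferInstance
  have hE : Module.Injective R E :=
    (Module.injective_iff_injective_object R E).2 (inferInstanceAs (Injective E))
  exact ⟨_, _, _, _, _, _, j, _, hE, isSES_range hj,
    (isSES_range hj).idLE_right hM (idLE_of_injective hE n)⟩

theorem IdLE.pi {ι : Type u} {X : ι → Type u} [∀ i, AddCommGroup (X i)] [∀ i, Module R (X i)]
    {n : ℕ} (hX : ∀ i, IdLE R n (X i)) : IdLE R n (∀ i, X i) := by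
  induction n generalizing X with
  | zero =>
    have : ∀ i, Module.Injective R (X i) := fun i ↦ idLE_zero_iff.1 (hX i)
    exact idLE_zero_iff.2 inferInstance
  | succ n ih =>
    choose E N _ _ _ _ f g hE hfg hN using fun i ↦ (hX i).exists_isSES
    have hs : IsSES (LinearMap.pi fun i ↦ f i ∘ₗ LinearMap.proj i)
        (LinearMap.pi fun i ↦ g i ∘ₗ LinearMap.proj i) := by
      refine ⟨fun x y hxy ↦ funext fun i ↦ (hfg i).inj (congrFun hxy i), fun y ↦ ?_, fun x ↦ ?_⟩
      · choose x hx using fun i ↦ (hfg i).surj (y i)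
        exact ⟨x, funext hx⟩
      · constructor
        · intro hx
          choose y hy using fun i ↦ ((hfg i).exact (x i)).1 (congrFun hx i)
          exact ⟨y, funext hy⟩
        · rintro ⟨y, rfl⟩
          exact funext fun i ↦ (hfg i).apply_apply_eq_zero (y i)
    exact hs.idLE_left (idLE_of_injective inferInstance _) (ih hN)

end Dimension

/-! ### Flat modules over a semiprimary ring are projective -/

section FlatProjective

variable {R : Type u} [Ring R]

variable (R) in
/-- The class of `n ⊗ m` in the balanced tensor product. -/
def BalancedTensor.tmul {N M : Type u} [AddCommGroup N] [Module Rᵐᵒᵖ N] [AddCommGroup M]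
    [Module R M] (n : N) (m : M) : BalancedTensor R N M :=
  QuotientAddGroup.mk' (balancingRelations R N M) (n ⊗ₜ[ℤ] m)

section

variable {N N' M : Type u} [AddCommGroup N] [Module Rᵐᵒᵖ N] [AddCommGroup N'] [Module Rᵐᵒᵖ N']
  [AddCommGroup M] [Module R M]

theorem BalancedTensor.smul_tmul (r : R) (n : N) (m : M) :
    tmul R (MulOpposite.op r • n) m = tmul R n (r • m) := by
  rw [← sub_eq_zero, tmul, tmul, ← map_sub]
  exact (QuotientAddGroup.eq_zero_iff _).2 (AddSubgroup.subset_closure ⟨n, r, m, rfl⟩)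

theorem BalancedTensor.tmul_add (n : N) (m m' : M) :
    tmul R n (m + m') = tmul R n m + tmul R n m' := by
  simp only [tmul, TensorProduct.tmul_add, map_add]

theorem BalancedTensor.tmul_zero (n : N) : tmul R n (0 : M) = 0 := by
  simp only [tmul, TensorProduct.tmul_zero, map_zero]

theorem BalancedTensor.map_tmul (f : N →ₗ[Rᵐᵒᵖ] N') (n : N) (m : M) :
    BalancedTensor.map M f (tmul R n m) = tmul R (f n) m := rfl

theorem BalancedTensor.induction_on {motive : BalancedTensor R N M → Prop}
    (x : BalancedTensor R N M) (zero : motive 0) (tmul : ∀ n m, motive (tmul R n m))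
    (add : ∀ x y, motive x → motive y → motive (x + y)) : motive x := by
  obtain ⟨t, rfl⟩ := QuotientAddGroup.mk'_surjective _ x
  induction t with
  | zero => rwa [map_zero]
  | tmul n m => exact tmul n m
  | add x y hx hy => rw [map_add]; exact add _ _ hx hy

/-- The map out of the balanced tensor product given by a balanced biadditive map. -/
def BalancedTensor.lift {Q : Type u} [AddCommGroup Q] (f : N →+ M →+ Q)
    (hf : ∀ (r : R) n m, f (MulOpposite.op r • n) m = f n (r • m)) :
    BalancedTensor R N M →+ Q :=
  QuotientAddGroup.lift _ (TensorProduct.liftAddHom f fun z n m ↦ by simp) <| by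
    refine (AddSubgroup.closure_le _).2 ?_
    rintro _ ⟨n, r, m, rfl⟩
    simp [hf]

end

variable {M : Type u} [AddCommGroup M] [Module R M]

/-- A section `s` of the free cover of `M` embeds `N ⊗_R M` into `M →₀ N` by `n ⊗ m ↦ n · s m`,
naturally in `N`, and injectivity in the target can be checked coordinatewise. -/
theorem isFlat_of_projective [hM : Module.Projective R M] : IsFlat R M := by
  obtain ⟨s, hs⟩ := hM.out
  let φ (N : Type u) [AddCommGroup N] [Module Rᵐᵒᵖ N] : BalancedTensor R N M →+ (M →₀ N) :=
    BalancedTensor.lift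
      (AddMonoidHom.mk' (fun n ↦ AddMonoidHom.mk'
        (fun m ↦ (s m).mapRange (fun r ↦ MulOpposite.op r • n) (by simp))
          (fun m m' ↦ by ext; simp [add_smul]))
        (fun n n' ↦ by ext; simp))
      (fun r n m ↦ by ext; simp [mul_smul])
  have hφ (N : Type u) [AddCommGroup N] [Module Rᵐᵒᵖ N] : Function.Injective (φ N) := by
    let ψ : (M →₀ N) →+ BalancedTensor R N M := Finsupp.liftAddHom fun m ↦
      AddMonoidHom.mk' (fun n ↦ BalancedTensor.tmul R n m) (fun n n' ↦ by
        simp only [BalancedTensor.tmul, TensorProduct.add_tmul, map_add])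
    have hψ (x) : ψ (φ N x) = x := by
      induction x using BalancedTensor.induction_on with
      | zero => simp
      | add x y hx hy => rw [map_add, map_add, hx, hy]
      | tmul n m =>
        have h1 : ψ (φ N (BalancedTensor.tmul R n m)) =
            (s m).sum fun i r ↦ BalancedTensor.tmul R n (r • i) := by
          change ψ ((s m).mapRange (fun r ↦ MulOpposite.op r • n) (by simp)) = _
          simp only [ψ, Finsupp.liftAddHom_apply]
          rw [Finsupp.sum_mapRange_index (by simp [BalancedTensor.tmul])]
          refine Finsupp.sum_congr fun i _ ↦ ?_
          exact BalancedTensor.smul_tmul _ _ _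
        rw [h1]
        conv_rhs => rw [← hs m, Finsupp.linearCombination_apply]
        rw [Finsupp.sum, Finsupp.sum]
        exact (map_sum (AddMonoidHom.mk' (fun y : M ↦ BalancedTensor.tmul R n y)
          (BalancedTensor.tmul_add n)) _ _).symm
    exact Function.LeftInverse.injective hψ
  intro N N' _ _ _ _ f hf
  have hnat (x) : φ N' (BalancedTensor.map M f x) =
      Finsupp.mapRange f (map_zero f) (φ N x) := by
    induction x using BalancedTensor.induction_on with
    | zero => simp
    | add x y hx hy =>
      rw [map_add, map_add, map_add, hx, hy, Finsupp.mapRange_add (map_add f)]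
    | tmul n m =>
      rw [BalancedTensor.map_tmul]
      ext i
      exact (map_smul f _ _).symm
  intro x y hxy
  refine hφ N (Finsupp.mapRange_injective f (map_zero f) hf ?_)
  rw [← hnat, ← hnat, hxy]

/-- A two-sided ideal as a right submodule of the ring. -/
def rightSubmodule (J : Ideal R) [J.IsTwoSided] : Submodule Rᵐᵒᵖ R where
  carrier := J
  add_mem' := J.add_mem
  zero_mem' := J.zero_mem
  smul_mem' r _ hx := J.mul_mem_right r.unop hx

/-- This expresses `Tor₁(R/J, M) = 0`. For a set-theoretic section `s` of `p`, the rule `j ⊗ m ↦ j •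
s m` is well defined modulo `J • ker p`. A tensor in `J ⊗ M` lying over `x` becomes `1 ⊗ p x = 0` in
`R ⊗ M`, so it is zero by flatness. -/
theorem IsFlat.mem_smul_ker (hM : IsFlat R M) (J : Ideal R) [J.IsTwoSided] {F : Type u}
    [AddCommGroup F] [Module R F] (p : F →ₗ[R] M) (hp : Function.Surjective p) {x : F}
    (hx : x ∈ J • (⊤ : Submodule R F)) (hpx : p x = 0) : x ∈ J • LinearMap.ker p := by
  let JJ := rightSubmodule J
  let s := Function.surjInv hp
  have hs : ∀ m, p (s m) = m := Function.surjInv_eq hp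
  have key {j : R} (hj : j ∈ J) {y z : F} (h : p y = p z) :
      Submodule.Quotient.mk (p := J • LinearMap.ker p) (j • y) = Submodule.Quotient.mk (j • z) := by
    rw [Submodule.Quotient.eq, ← smul_sub]
    exact Submodule.smul_mem_smul hj (by simp [h])
  let Φ : BalancedTensor R JJ M →+ F ⧸ (J • LinearMap.ker p) := BalancedTensor.lift
    (AddMonoidHom.mk' (fun j ↦ AddMonoidHom.mk' (fun m ↦ Submodule.Quotient.mk (j.1 • s m))
        (fun m m' ↦ by
          rw [← Submodule.Quotient.mk_add, ← smul_add]
          exact key j.2 (by simp [hs])))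
      (fun j j' ↦ by ext m; simp [add_smul]))
    (fun r j m ↦ by
      change Submodule.Quotient.mk ((j.1 * r) • s m) = Submodule.Quotient.mk (j.1 • s (r • m))
      rw [mul_smul]
      exact key j.2 (by simp [hs]))
  have hΦ (j : JJ) (m : M) :
    Φ (BalancedTensor.tmul R j m) = Submodule.Quotient.mk (j.1 • s m) := rfl
  obtain ⟨t, ht1, ht2⟩ : ∃ t : BalancedTensor R JJ M, Φ t = Submodule.Quotient.mk x ∧
      BalancedTensor.map M JJ.subtype t = BalancedTensor.tmul R (1 : R) (p x) := by
    clear hpx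
    induction hx using Submodule.smul_induction_on' with
    | smul j hj y _ =>
      refine ⟨BalancedTensor.tmul R (⟨j, hj⟩ : JJ) (p y), ?_, ?_⟩
      · rw [hΦ]
        exact key hj (by simp [hs])
      · rw [BalancedTensor.map_tmul, map_smul, ← BalancedTensor.smul_tmul]
        simp
    | add x _ y _ hx hy =>
      obtain ⟨t, h1, h2⟩ := hx
      obtain ⟨t', h1', h2'⟩ := hy
      exact ⟨t + t', by simp [h1, h1'], by
        rw [map_add, h2, h2', map_add, BalancedTensor.tmul_add]⟩
  have ht : t = 0 := hM JJ.subtype JJ.injective_subtype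
    (by rw [ht2, hpx, BalancedTensor.tmul_zero, map_zero])
  rw [ht, map_zero] at ht1
  exact (Submodule.Quotient.mk_eq_zero _).1 ht1.symm

theorem isSemisimpleModule_of_jacobson_smul [IsSemiprimaryRing R]
    (h : Module.IsTorsionBySet R M (Ring.jacobson R)) : IsSemisimpleModule R M := by
  let _ := h.module
  exact (h.semilinearMap.isSemisimpleModule_iff_of_bijective Function.bijective_id).2
    inferInstance

instance isSemisimpleModule_quotient_jacobson [IsSemiprimaryRing R] :
    IsSemisimpleModule R (M ⧸ (Ring.jacobson R • ⊤ : Submodule R M)) :=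
  isSemisimpleModule_of_jacobson_smul <| (Module.isTorsionBySet_quotient_iff _ _).2
    fun _ _ hi ↦ Submodule.smul_mem_smul hi trivial

/-- An endomorphism with image in `J • M` is nilpotent if `J` is. -/
theorem isNilpotent_of_forall_mem_smul {J : Ideal R} [J.IsTwoSided] (hJ : IsNilpotent J)
    (g : Module.End R M) (hg : ∀ x, g x ∈ J • (⊤ : Submodule R M)) : IsNilpotent g := by
  obtain ⟨n, hn⟩ := hJ
  have key (i : ℕ) (x : M) : (g ^ i) x ∈ J ^ i • (⊤ : Submodule R M) := by
    induction i with
    | zero => simp [Submodule.pow_zero, Ideal.one_eq_top]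
    | succ i ih =>
      rw [pow_succ', Module.End.mul_apply]
      have : Submodule.map g (J ^ i • (⊤ : Submodule R M)) ≤ J ^ (i + 1) • ⊤ := by
        rw [Submodule.map_smul'', Submodule.pow_succ, Submodule.mul_smul]
        refine Submodule.smul_mono le_rfl ?_
        rintro _ ⟨y, _, rfl⟩
        exact hg y
      exact this ⟨_, ih, rfl⟩
  exact ⟨n, LinearMap.ext fun x ↦ by simpa [hn] using key n x⟩

/-- Over a semiprimary ring, a submodule `K` of a projective module `F` with `K ∩ JF = JK` is a
direct summand. -/
theorem exists_retraction_of_mem_smul [IsSemiprimaryRing R] {F : Type u} [AddCommGroup F]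
    [Module R F] [Module.Projective R F] (K : Submodule R F)
    (hK : ∀ x ∈ K, x ∈ Ring.jacobson R • (⊤ : Submodule R F) → x ∈ Ring.jacobson R • K) :
    ∃ ρ : F →ₗ[R] K, ρ ∘ₗ K.subtype = LinearMap.id := by
  let π : F →ₗ[R] F ⧸ (Ring.jacobson R • ⊤ : Submodule R F) := Submodule.mkQ _
  obtain ⟨C, hC⟩ := exists_isCompl (K.map π)
  let r : (F ⧸ (Ring.jacobson R • ⊤ : Submodule R F)) →ₗ[R] K.map π :=
    Submodule.projectionOnto _ _ hC
  let t : K →ₗ[R] K.map π := π.restrict fun x hx ↦ Submodule.mem_map_of_mem hx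
  have ht : Function.Surjective t := by
    rintro ⟨_, x, hx, rfl⟩
    exact ⟨⟨x, hx⟩, rfl⟩
  -- `q` lifts the projection onto the image of `K` modulo the radical, so on `K` it is the identity
  -- only up to `J K`. The error is nilpotent, hence `q` restricted to `K` is invertible and its
  -- inverse corrects `q`.
  obtain ⟨q, hq⟩ := Module.projective_lifting_property t (r ∘ₗ π) ht
  have hqK (x : K) : (x - q x : K) ∈ Ring.jacobson R • (⊤ : Submodule R K) := by
    have h1 : t (q x) = t x := by
      have h2 := LinearMap.congr_fun hq (x : F)
      have h3 : r (t x) = t x := Submodule.projectionOnto_apply_left hC (t x)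
      exact h2.trans h3
    have h4 : ((x : F) - q x) ∈ Ring.jacobson R • (⊤ : Submodule R F) := by
      rw [← Submodule.Quotient.eq]
      exact (congrArg Subtype.val h1).symm
    have h5 := hK _ (K.sub_mem x.2 (q x).2) h4
    have h6 : Ring.jacobson R • K = (Ring.jacobson R • (⊤ : Submodule R K)).map K.subtype := by
      rw [Submodule.map_smul'', Submodule.map_top, Submodule.range_subtype]
    rw [h6] at h5
    obtain ⟨y, hy, hyx⟩ := h5
    have : y = x - q x := Subtype.ext hyx
    rwa [← this]
  have hnil := isNilpotent_of_forall_mem_smul (IsSemiprimaryRing.isNilpotent (R := R))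
    (1 - q ∘ₗ K.subtype : Module.End R K) hqK
  have hu := hnil.isUnit_one_sub
  rw [sub_sub_cancel] at hu
  obtain ⟨w, hw⟩ := hu
  refine ⟨(↑w⁻¹ : Module.End R K) ∘ₗ q, ?_⟩
  rw [LinearMap.comp_assoc, ← hw]
  exact w.inv_mul

/-- By `IsFlat.mem_smul_ker` the kernel of a free cover meets the summand criterion above, so the
cover splits. -/
theorem IsFlat.projective [IsSemiprimaryRing R] (hM : IsFlat R M) : Module.Projective R M := by
  have hp := Finsupp.linearCombination_id_surjective R M
  obtain ⟨ρ, hρ⟩ := exists_retraction_of_mem_smul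
    (LinearMap.ker (Finsupp.linearCombination R (id : M → M)))
    fun x hxK hxJ ↦ hM.mem_smul_ker _ _ hp hxJ hxK
  obtain ⟨e⟩ := (isSES_ker hp).nonempty_prodEquiv_of_retraction ρ hρ
  exact pdLE_zero_iff.1 (PdLE.of_prodEquiv_right (pdLE_of_projective 0) e)

theorem flatDimLE_iff [IsSemiprimaryRing R] {n : ℕ} (M : ModuleCat.{u} R) :
    FlatDimLE R n M ↔ PdLE R n M := by
  induction n generalizing M with
  | zero =>
    rw [pdLE_zero_iff]
    exact ⟨fun h ↦ IsFlat.projective h, fun h ↦ isFlat_of_projective⟩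
  | succ n ih =>
    constructor
    · rintro ⟨F, p, hF, hp, hK⟩
      have := hF.projective
      exact (isSES_ker hp).pdLE_right ((ih _).1 hK) (pdLE_of_projective _)
    · intro h
      refine ⟨ModuleCat.of R (M →₀ R), Finsupp.linearCombination R id, isFlat_of_projective,
        Finsupp.linearCombination_id_surjective R M, (ih _).2 ?_⟩
      exact (isSES_ker (Finsupp.linearCombination_id_surjective R M)).pdLE_left
        (pdLE_of_projective n) h

end FlatProjective

/-! ### Injective envelopes -/

section Envelope

variable {R : Type u} [Ring R]

variable {E : Type u} [AddCommGroup E] [Module R E]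

/-- Zorn's lemma: essentiality is tested on cyclic submodules, and a cyclic submodule of the union
of a chain lies in one member. -/
theorem exists_le_maximal_essential (K : Submodule R E) :
    ∃ C : Submodule R E, Maximal (fun C ↦ K ≤ C ∧ ∀ L ≤ C, L ⊓ K = ⊥ → L = ⊥) C := by
  suffices h : ∀ c ⊆ {C | K ≤ C ∧ ∀ L ≤ C, L ⊓ K = ⊥ → L = ⊥}, IsChain (· ≤ ·) c → ∀ y ∈ c,
      ∃ ub ∈ {C | K ≤ C ∧ ∀ L ≤ C, L ⊓ K = ⊥ → L = ⊥}, ∀ z ∈ c, z ≤ ub by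
    obtain ⟨C, -, hC⟩ := zorn_le_nonempty₀ _ h K
      ⟨le_rfl, fun L hL h ↦ by rwa [inf_eq_left.2 hL] at h⟩
    exact ⟨C, hC⟩
  intro c hc hchain y hy
  refine ⟨sSup c, ⟨(hc hy).1.trans (le_sSup hy), fun L hL h ↦ ?_⟩, fun z hz ↦ le_sSup hz⟩
  rw [eq_bot_iff]
  intro x hx
  obtain ⟨D, hD, hxD⟩ := (Submodule.mem_sSup_of_directed ⟨y, hy⟩ hchain.directedOn).1 (hL hx)
  have := (hc hD).2 (R ∙ x) (by simpa using hxD) (by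
    rw [eq_bot_iff, ← h]
    exact inf_le_inf_right _ (by simpa using hx))
  simpa using this

theorem exists_maximal_disjoint (C : Submodule R E) :
    ∃ K : Submodule R E, Maximal (fun K ↦ K ⊓ C = ⊥) K := by
  suffices h : ∀ c ⊆ {K : Submodule R E | K ⊓ C = ⊥}, IsChain (· ≤ ·) c → ∀ y ∈ c,
      ∃ ub ∈ {K : Submodule R E | K ⊓ C = ⊥}, ∀ z ∈ c, z ≤ ub by
    obtain ⟨K, -, hK⟩ := zorn_le_nonempty₀ _ h ⊥ (bot_inf_eq C)
    exact ⟨K, hK⟩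
  intro c hc hchain y hy
  refine ⟨sSup c, ?_, fun z hz ↦ le_sSup hz⟩
  change _ = _
  rw [eq_bot_iff]
  rintro x ⟨hx, hxC⟩
  obtain ⟨D, hD, hxD⟩ := (Submodule.mem_sSup_of_directed ⟨y, hy⟩ hchain.directedOn).1 hx
  rw [← show D ⊓ C = ⊥ from hc hD]
  exact ⟨hxD, hxC⟩

/-- A map that is injective on an essential submodule is injective. -/
theorem IsEssential.injective {K : Submodule R E} (hK : IsEssential K) {N : Type u}
    [AddCommGroup N] [Module R N] (f : E →ₗ[R] N) (hf : ∀ x ∈ K, f x = 0 → x = 0) :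
    Function.Injective f := by
  rw [← LinearMap.ker_eq_bot]
  refine hK _ ?_
  rw [eq_bot_iff]
  rintro x ⟨hx, hxK⟩
  exact hf x hxK hx

/-- A maximal essential extension inside an injective module is injective. -/
theorem injective_of_maximal_essential (hE : Module.Injective R E) {K C : Submodule R E}
    (hC : Maximal (fun C ↦ K ≤ C ∧ ∀ L ≤ C, L ⊓ K = ⊥ → L = ⊥) C) : Module.Injective R C := by
  -- Maximality of `D` makes `C → E/D` an essential embedding. Extending `C ⊆ E` to `ψ : E/D → E`
  -- produces an essential extension of `K` containing `C`; by maximality its image is `C`, and `ψ`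
  -- gives a retraction of `E` onto `C`.
  obtain ⟨D, hD⟩ := exists_maximal_disjoint C
  let φ : C →ₗ[R] E ⧸ D := D.mkQ ∘ₗ C.subtype
  have hφ0 (c : C) (hc : φ c = 0) : c = 0 := by
    have h1 : (c : E) ∈ D ⊓ C := ⟨(Submodule.Quotient.mk_eq_zero D).1 hc, c.2⟩
    rw [hD.prop] at h1
    exact Subtype.ext h1
  have hφ : Function.Injective φ := (injective_iff_map_eq_zero φ).2 hφ0
  have hess : IsEssential (LinearMap.range φ) := by
    intro L hL
    have h1 : L.comap D.mkQ ⊓ C = ⊥ := by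
      rw [eq_bot_iff]
      rintro x ⟨hx, hxC⟩
      have h2 : φ ⟨x, hxC⟩ ∈ L ⊓ LinearMap.range φ := ⟨hx, ⟨_, rfl⟩⟩
      rw [hL] at h2
      exact congrArg Subtype.val (hφ0 _ h2)
    have h3 : D ≤ L.comap D.mkQ := by
      intro x hx
      have : D.mkQ x = 0 := (Submodule.Quotient.mk_eq_zero D).2 hx
      simp [this]
    rw [eq_bot_iff]
    intro x hx
    obtain ⟨x, rfl⟩ := D.mkQ_surjective x
    exact (Submodule.Quotient.mk_eq_zero D).2 (hD.le_of_ge h1 h3 hx)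
  obtain ⟨ψ, hψ⟩ := exists_extension_of_injective hE hφ C.subtype
  have hψ' (c : C) : ψ (φ c) = c := LinearMap.congr_fun hψ c
  have hrange : LinearMap.range ψ ≤ C := by
    refine hC.le_of_ge ⟨hC.prop.1.trans ?_, fun L hL hLK ↦ ?_⟩ ?_
    · exact fun x hx ↦ ⟨φ ⟨x, hx⟩, hψ' _⟩
    · have h1 : L ⊓ C = ⊥ := hC.prop.2 _ inf_le_right (by
        rw [eq_bot_iff, ← hLK]
        exact inf_le_inf_right _ inf_le_left)
      have h2 : L.comap ψ = ⊥ := by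
        refine hess _ ?_
        rw [eq_bot_iff]
        rintro _ ⟨hx, c, rfl⟩
        have h3 : (c : E) ∈ L ⊓ C := ⟨by simpa [hψ'] using hx, c.2⟩
        rw [h1] at h3
        have : c = 0 := Subtype.ext h3
        simp [this]
      rw [eq_bot_iff]
      intro x hx
      obtain ⟨y, rfl⟩ := hL hx
      have : y ∈ L.comap ψ := hx
      rw [h2] at this
      simp [(Submodule.mem_bot R).1 this]
    · exact fun x hx ↦ ⟨φ ⟨x, hx⟩, hψ' _⟩
  refine injective_of_retract hE C.subtype
    ((ψ ∘ₗ D.mkQ).codRestrict C fun x ↦ hrange ⟨_, rfl⟩) ?_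
  ext c
  exact hψ' c

theorem exists_injective_envelope (M : ModuleCat.{u} R) :
    ∃ (E : ModuleCat.{u} R) (f : M →ₗ[R] E), Module.Injective R E ∧ Function.Injective f ∧
      IsEssential (LinearMap.range f) := by
  let E := Injective.under M
  let j : M →ₗ[R] E := (Injective.ι M).hom
  have hj : Function.Injective j := (ModuleCat.mono_iff_injective _).1 inferInstance
  have hE : Module.Injective R E :=
    (Module.injective_iff_injective_object R E).2 (inferInstanceAs (Injective E))
  obtain ⟨C, hC⟩ := exists_le_maximal_essential (LinearMap.range j)
  refine ⟨ModuleCat.of R C, j.codRestrict C fun x ↦ hC.prop.1 ⟨x, rfl⟩,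
    injective_of_maximal_essential hE hC, fun x y hxy ↦ hj (congrArg Subtype.val hxy), ?_⟩
  intro L hL
  have h1 : L.map C.subtype = ⊥ := by
    refine hC.prop.2 _ (Submodule.map_subtype_le C L) ?_
    rw [eq_bot_iff]
    rintro _ ⟨⟨x, hx, rfl⟩, y, hy⟩
    have h2 : x ∈ L ⊓ LinearMap.range (j.codRestrict C fun x ↦ hC.prop.1 ⟨x, rfl⟩) :=
      ⟨hx, y, Subtype.ext hy⟩
    rw [hL] at h2
    simp [(Submodule.mem_bot R).1 h2]
  exact Submodule.map_injective_of_injective C.injective_subtype (h1.trans (Submodule.map_bot _).symm)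

/-- An injective envelope of `M`. -/
noncomputable def envelope (M : ModuleCat.{u} R) : ModuleCat.{u} R :=
  (exists_injective_envelope M).choose

/-- The embedding of `M` into its injective envelope. -/
noncomputable def toEnvelope (M : ModuleCat.{u} R) : M →ₗ[R] envelope M :=
  (exists_injective_envelope M).choose_spec.choose

theorem injective_envelope (M : ModuleCat.{u} R) : Module.Injective R (envelope M) :=
  (exists_injective_envelope M).choose_spec.choose_spec.1

theorem toEnvelope_injective (M : ModuleCat.{u} R) : Function.Injective (toEnvelope M) :=
  (exists_injective_envelope M).choose_spec.choose_spec.2.1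

theorem isEssential_range_toEnvelope (M : ModuleCat.{u} R) :
    IsEssential (LinearMap.range (toEnvelope M)) :=
  (exists_injective_envelope M).choose_spec.choose_spec.2.2

/-- The iterated cosyzygies of `M`. -/
noncomputable def cosyzygy (M : ModuleCat.{u} R) : ℕ → ModuleCat.{u} R
  | 0 => M
  | i + 1 => ModuleCat.of R
      (envelope (cosyzygy M i) ⧸ LinearMap.range (toEnvelope (cosyzygy M i)))

/-- The projection from the injective envelope of a cosyzygy to the next cosyzygy. -/
noncomputable def toCosyzygy (M : ModuleCat.{u} R) (i : ℕ) :
    envelope (cosyzygy M i) →ₗ[R] cosyzygy M (i + 1) :=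
  (LinearMap.range (toEnvelope (cosyzygy M i))).mkQ

theorem isSES_cosyzygy (M : ModuleCat.{u} R) (i : ℕ) :
    IsSES (toEnvelope (cosyzygy M i)) (toCosyzygy M i) :=
  isSES_range (toEnvelope_injective _)

/-- The minimal injective coresolution obtained by splicing injective envelopes. -/
noncomputable def minimalInjectiveCoresolution (M : ModuleCat.{u} R) :
    MinimalInjectiveCoresolution M where
  E i := envelope (cosyzygy M i)
  ι := toEnvelope M
  d i := toEnvelope (cosyzygy M (i + 1)) ∘ₗ toCosyzygy M i
  injective i := injective_envelope _
  ι_injective := toEnvelope_injective M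
  exact_zero x := by
    rw [LinearMap.comp_apply, map_eq_zero_iff _ (toEnvelope_injective _)]
    exact (isSES_cosyzygy M 0).exact x
  exact_succ i x := by
    rw [LinearMap.comp_apply, map_eq_zero_iff _ (toEnvelope_injective _),
      (isSES_cosyzygy M (i + 1)).exact x]
    exact ((isSES_cosyzygy M i).surj.range_comp _).symm ▸ Iff.rfl
  essential_zero := isEssential_range_toEnvelope M
  essential_succ i := by
    rw [LinearMap.range_comp_of_range_eq_top _ (LinearMap.range_eq_top.2 (isSES_cosyzygy M i).surj)]
    exact isEssential_range_toEnvelope _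

end Envelope

/-! ### Injective coresolutions with bounded projective dimensions -/

section Coresolution

variable {R : Type u} [Ring R]

variable (R) in
/-- `M` has a partial injective coresolution `0 → M → E⁰ → ⋯ → Eⁿ⁻¹`, not necessarily minimal,
with `pd Eⁱ ≤ s + i`. -/
def CoresLE : ℕ → ℕ → ∀ (M : Type u) [AddCommGroup M] [Module R M], Prop
  | 0, _, _, _, _ => True
  | n + 1, s, M, _, _ => ∃ (E N : Type u) (_ : AddCommGroup E) (_ : Module R E)
      (_ : AddCommGroup N) (_ : Module R N) (f : M →ₗ[R] E) (g : E →ₗ[R] N),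
      Module.Injective R E ∧ PdLE R s E ∧ IsSES f g ∧ CoresLE n (s + 1) N

variable {A B C E M N P : Type u} [AddCommGroup A] [Module R A] [AddCommGroup B] [Module R B]
  [AddCommGroup C] [Module R C] [AddCommGroup E] [Module R E] [AddCommGroup M] [Module R M]
  [AddCommGroup N] [Module R N] [AddCommGroup P] [Module R P]

namespace CoresLE

theorem mono {n s t : ℕ} (h : CoresLE R n s M) (hst : s ≤ t) : CoresLE R n t M := by
  induction n generalizing s t M with
  | zero => trivial
  | succ n ih =>
    obtain ⟨E, N, _, _, _, _, f, g, hE, hpd, hfg, hN⟩ := h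
    exact ⟨E, N, _, _, _, _, f, g, hE, hpd.mono hst, hfg, ih hN (Nat.succ_le_succ hst)⟩

theorem of_subsingleton [Subsingleton M] (n s : ℕ) : CoresLE R n s M := by
  induction n generalizing s with
  | zero => trivial
  | succ n ih =>
    have hM : Module.Injective R M := ⟨fun _ _ _ _ _ _ _ _ _ ↦ ⟨0, fun _ ↦ Subsingleton.elim _ _⟩⟩
    exact ⟨M, M, _, _, _, _, LinearMap.id, 0, hM, pdLE_of_subsingleton s,
      ⟨Function.injective_id, fun x ↦ ⟨0, Subsingleton.elim _ _⟩,
        fun x ↦ ⟨fun _ ↦ ⟨x, rfl⟩, fun _ ↦ rfl⟩⟩, ih _⟩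

theorem of_injective {s : ℕ} (hE : Module.Injective R E) (hpd : PdLE R s E) (n : ℕ) :
    CoresLE R n s E := by
  cases n with
  | zero => trivial
  | succ n =>
    exact ⟨E, PUnit, _, _, _, _, LinearMap.id, 0, hE, hpd,
      ⟨Function.injective_id, fun x ↦ ⟨0, Subsingleton.elim _ _⟩,
        fun x ↦ ⟨fun _ ↦ ⟨x, rfl⟩, fun _ ↦ rfl⟩⟩, of_subsingleton _ _⟩

/-- The dual horseshoe: `B` embeds in `E × E'`, and the cokernels again form a short exact sequence.
-/
theorem of_isSES {α : A →ₗ[R] B} {β : B →ₗ[R] C} (h : IsSES α β) {n s : ℕ}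
    (hA : CoresLE R n s A) (hC : CoresLE R n s C) : CoresLE R n s B := by
  induction n generalizing s A B C with
  | zero => trivial
  | succ n ih =>
    obtain ⟨E, N, _, _, _, _, a, p, hE, hpd, hap, hN⟩ := hA
    obtain ⟨E', N', _, _, _, _, c, q, hE', hpd', hcq, hN'⟩ := hC
    obtain ⟨a', ha'⟩ := exists_extension_of_injective hE h.inj a
    have ha (x) : a' (α x) = a x := LinearMap.congr_fun ha' x
    let j : B →ₗ[R] E × E' := a'.prod (c ∘ₗ β)
    have hj : Function.Injective j := by
      rw [injective_iff_map_eq_zero]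
      intro b hb
      obtain ⟨h1, h2⟩ : a' b = 0 ∧ c (β b) = 0 := by simpa [j] using hb
      obtain ⟨x, rfl⟩ := (h.exact b).1 (hcq.inj (by rw [h2, map_zero]))
      have : x = 0 := hap.inj (by rw [← ha, h1, map_zero])
      simp [this]
    let Q := (E × E') ⧸ LinearMap.range j
    let φ : N →ₗ[R] Q := hap.desc ((LinearMap.range j).mkQ ∘ₗ LinearMap.inl R E E') (by
      ext x
      refine (Submodule.Quotient.mk_eq_zero _).2 ⟨α x, ?_⟩
      simp [j, ha, h.apply_apply_eq_zero])
    have hφ (e : E) : φ (p e) = (LinearMap.range j).mkQ (e, 0) := hap.desc_apply _ _ _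
    let ψ : Q →ₗ[R] N' := (LinearMap.range j).liftQ (q ∘ₗ LinearMap.snd R E E') (by
      rintro _ ⟨b, rfl⟩
      simp [j, hcq.apply_apply_eq_zero])
    have hψ (e : E) (e' : E') : ψ ((LinearMap.range j).mkQ (e, e')) = q e' := rfl
    refine ⟨E × E', Q, _, _, _, _, j, (LinearMap.range j).mkQ, injective_prod hE hE',
      hpd.prod hpd', isSES_range hj, ih (α := φ) (β := ψ) ⟨?_, ?_, ?_⟩ hN hN'⟩
    · rw [injective_iff_map_eq_zero]
      intro x hx
      obtain ⟨e, rfl⟩ := hap.surj x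
      rw [hφ] at hx
      obtain ⟨b, hb⟩ := (Submodule.Quotient.mk_eq_zero _).1 hx
      obtain ⟨h1, h2⟩ : a' b = e ∧ c (β b) = 0 := by simpa [j] using hb
      obtain ⟨x, rfl⟩ := (h.exact b).1 (hcq.inj (by rw [h2, map_zero]))
      rw [← h1, ha, hap.apply_apply_eq_zero]
    · intro y
      obtain ⟨e', rfl⟩ := hcq.surj y
      exact ⟨_, hψ 0 e'⟩
    · intro x
      constructor
      · intro hx
        obtain ⟨⟨e, e'⟩, rfl⟩ := Submodule.mkQ_surjective _ x
        rw [hψ] at hx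
        obtain ⟨y, rfl⟩ := (hcq.exact e').1 hx
        obtain ⟨b, rfl⟩ := h.surj y
        refine ⟨p (e - a' b), ?_⟩
        rw [hφ]
        refine (Submodule.Quotient.eq _).2 ⟨-b, ?_⟩
        simp [j]
      · rintro ⟨y, rfl⟩
        obtain ⟨e, rfl⟩ := hap.surj y
        rw [hφ, hψ, map_zero]

/-- For `A ⊆ B ⊆ E` the cokernel `E/A` is an extension of `E/B` by `B/A = C`. As `C` enters one
stage later, one term fewer and the bound `s + 1` suffice for it. -/
theorem left_of_isSES {i : A →ₗ[R] B} {q : B →ₗ[R] C} (h : IsSES i q) {n s : ℕ}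
    (hB : CoresLE R (n + 1) s B) (hC : CoresLE R n (s + 1) C) : CoresLE R (n + 1) s A := by
  obtain ⟨E, N, _, _, _, _, f, g, hE, hpd, hfg, hN⟩ := hB
  have hj : Function.Injective (f ∘ₗ i) := hfg.inj.comp h.inj
  let K := LinearMap.range (f ∘ₗ i)
  let φ : C →ₗ[R] E ⧸ K := h.desc (K.mkQ ∘ₗ f) (by
    ext x
    exact (Submodule.Quotient.mk_eq_zero _).2 ⟨x, rfl⟩)
  have hφ (b) : φ (q b) = K.mkQ (f b) := h.desc_apply _ _ _
  let ψ : E ⧸ K →ₗ[R] N := K.liftQ g (by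
    rintro _ ⟨a, rfl⟩
    simp [hfg.apply_apply_eq_zero])
  have hψ (e) : ψ (K.mkQ e) = g e := by simp [ψ]
  refine ⟨E, E ⧸ K, _, _, _, _, f ∘ₗ i, K.mkQ, hE, hpd, isSES_range hj,
    of_isSES (α := φ) (β := ψ) ⟨?_, ?_, ?_⟩ hC hN⟩
  · rw [injective_iff_map_eq_zero]
    intro c hc
    obtain ⟨b, rfl⟩ := h.surj c
    rw [hφ] at hc
    obtain ⟨a, ha⟩ := (Submodule.Quotient.mk_eq_zero _).1 hc
    rw [← hfg.inj ha, h.apply_apply_eq_zero]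
  · intro y
    obtain ⟨e, rfl⟩ := hfg.surj y
    exact ⟨_, hψ e⟩
  · intro x
    constructor
    · intro hx
      obtain ⟨e, rfl⟩ := Submodule.mkQ_surjective _ x
      rw [hψ] at hx
      obtain ⟨b, rfl⟩ := (hfg.exact e).1 hx
      exact ⟨q b, hφ b⟩
    · rintro ⟨c, rfl⟩
      obtain ⟨b, rfl⟩ := h.surj c
      rw [hφ, hψ, hfg.apply_apply_eq_zero]

/-- Extending `A → E` to `B` gives `0 → B → E × C → N → 0`, which coresolves `E × C`. Then `C` is
the kernel of the projection onto the injective `E`, so `left_of_isSES` applies. -/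
theorem right_of_isSES {i : A →ₗ[R] B} {q : B →ₗ[R] C} (h : IsSES i q) {n s : ℕ}
    (hA : CoresLE R (n + 1) s A) (hB : CoresLE R n (s + 1) B) : CoresLE R n (s + 1) C := by
  obtain ⟨E, N, _, _, _, _, f, g, hE, hpd, hfg, hN⟩ := hA
  obtain ⟨F, hF'⟩ := exists_extension_of_injective hE h.inj f
  have hF (a) : F (i a) = f a := LinearMap.congr_fun hF' a
  let δ : C →ₗ[R] N := h.desc (g ∘ₗ F) (by
    ext a
    simp [hF, hfg.apply_apply_eq_zero])
  have hδ (b) : δ (q b) = g (F b) := h.desc_apply _ _ _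
  have hses : IsSES (F.prod q) (g.coprod (-δ)) := by
    refine ⟨?_, ?_, ?_⟩
    · rw [injective_iff_map_eq_zero]
      intro b hb
      obtain ⟨h1, h2⟩ : F b = 0 ∧ q b = 0 := by simpa using hb
      obtain ⟨a, rfl⟩ := (h.exact b).1 h2
      have : a = 0 := hfg.inj (by rw [← hF, h1, map_zero])
      simp [this]
    · intro y
      obtain ⟨e, rfl⟩ := hfg.surj y
      exact ⟨(e, 0), by simp⟩
    · rintro ⟨e, c⟩
      constructor
      · intro hec
        obtain ⟨b, rfl⟩ := h.surj c
        have h1 : g (e - F b) = 0 := by simpa [hδ, sub_eq_add_neg] using hec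
        obtain ⟨a, ha⟩ := (hfg.exact _).1 h1
        refine ⟨b + i a, ?_⟩
        simp [hF, ha, h.apply_apply_eq_zero]
      · rintro ⟨b, hb⟩
        obtain ⟨rfl, rfl⟩ : F b = e ∧ q b = c := by simpa using hb
        simp [hδ]
  have hEC := of_isSES hses hB hN
  cases n with
  | zero => trivial
  | succ n => exact left_of_isSES isSES_prod' hEC (of_injective hE (hpd.mono (by omega)) n)

/-- Coresolutions of `M` restrict to any injective envelope of `M`. -/
theorem envelope {n s : ℕ} (hM : CoresLE R (n + 1) s M) {ι : M →ₗ[R] E} {q : E →ₗ[R] N}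
    (hE : Module.Injective R E) (h : IsSES ι q) (hess : IsEssential (LinearMap.range ι)) :
    PdLE R s E ∧ CoresLE R n (s + 1) N := by
  obtain ⟨E', N', _, _, _, _, f, g, hE', hpd, hfg, hN⟩ := hM
  obtain ⟨ψ, hψ'⟩ := exists_extension_of_injective hE' h.inj f
  have hψ (m) : ψ (ι m) = f m := LinearMap.congr_fun hψ' m
  have hinj : Function.Injective ψ := hess.injective ψ (by
    rintro _ ⟨m, rfl⟩ hm
    have : m = 0 := hfg.inj (by rw [← hψ, hm, map_zero])
    simp [this])
  -- Essentiality has made `E` a summand of `E'`; the complement `E'/K` is injective and obeys the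
  -- same bound, and the cokernels fit into `0 → N → N' → E'/K → 0`.
  let K := LinearMap.range ψ
  have hs : IsSES ψ K.mkQ := isSES_range hinj
  obtain ⟨e⟩ := hs.nonempty_prodEquiv_of_injective hE
  refine ⟨hpd.of_prodEquiv_left e, ?_⟩
  have hK := of_injective (injective_of_prodEquiv_right hE' e) (hpd.of_prodEquiv_right e)
  cases n with
  | zero => trivial
  | succ n =>
    let φ : N →ₗ[R] N' := h.desc (g ∘ₗ ψ) (by
      ext m
      simp [hψ, hfg.apply_apply_eq_zero])
    have hφ (x) : φ (q x) = g (ψ x) := h.desc_apply _ _ _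
    let χ : N' →ₗ[R] E' ⧸ K := hfg.desc K.mkQ (by
      ext m
      exact (Submodule.Quotient.mk_eq_zero _).2 ⟨ι m, hψ m⟩)
    have hχ (y) : χ (g y) = K.mkQ y := hfg.desc_apply _ _ _
    refine left_of_isSES (i := φ) (q := χ) ⟨?_, ?_, ?_⟩ hN ((hK n).mono (by omega))
    · rw [injective_iff_map_eq_zero]
      intro x hx
      obtain ⟨x, rfl⟩ := h.surj x
      rw [hφ] at hx
      obtain ⟨m, hm⟩ := (hfg.exact _).1 hx
      have : ι m = x := hinj (by rw [hψ, hm])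
      rw [← this, h.apply_apply_eq_zero]
    · intro y
      obtain ⟨y, rfl⟩ := K.mkQ_surjective y
      exact ⟨g y, hχ y⟩
    · intro y
      obtain ⟨y, rfl⟩ := hfg.surj y
      rw [hχ]
      constructor
      · intro hy
        obtain ⟨x, rfl⟩ := (Submodule.Quotient.mk_eq_zero _).1 hy
        exact ⟨q x, hφ x⟩
      · rintro ⟨x, hx⟩
        obtain ⟨x, rfl⟩ := h.surj x
        rw [← hχ, ← hx, hφ, hχ]
        exact (Submodule.Quotient.mk_eq_zero _).2 ⟨x, rfl⟩

theorem cosyzygy {s : ℕ} {M : ModuleCat.{u} R} (hM : ∀ n, CoresLE R n s M) (i n : ℕ) :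
    CoresLE R n (s + i) (AuslanderType.cosyzygy M i) := by
  induction i generalizing n with
  | zero => exact hM n
  | succ i ih =>
    exact ((ih (n + 1)).envelope (injective_envelope _) (isSES_cosyzygy M i)
      (isEssential_range_toEnvelope _)).2

theorem pdLE_envelope {s : ℕ} {M : ModuleCat.{u} R} (hM : ∀ n, CoresLE R n s M) (i : ℕ) :
    PdLE R (s + i) (AuslanderType.envelope (AuslanderType.cosyzygy M i)) :=
  ((cosyzygy hM i 1).envelope (injective_envelope _) (isSES_cosyzygy M i)
      (isEssential_range_toEnvelope _)).1

theorem of_coresolution {M : ModuleCat.{u} R} (D : MinimalInjectiveCoresolution M) (s n i : ℕ)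
    (hD : ∀ j, i ≤ j → j < i + n → PdLE R (s + j) (D.E j)) (f : N →ₗ[R] D.E i)
    (hf : Function.Injective f) (hfd : Function.Exact f (D.d i)) : CoresLE R n (s + i) N := by
  induction n generalizing i N with
  | zero => trivial
  | succ n ih =>
    refine ⟨D.E i, LinearMap.range (D.d i), _, _, _, _, f, (D.d i).rangeRestrict, D.injective i,
      hD i le_rfl (by omega), ⟨hf, LinearMap.surjective_rangeRestrict _, ?_⟩,
      ih (i + 1) ?_ (LinearMap.range (D.d i)).subtype (Submodule.injective_subtype _) ?_⟩
    · intro x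
      rw [← hfd x]
      exact ⟨fun h ↦ congrArg Subtype.val h, fun h ↦ Subtype.ext h⟩
    · exact fun j hij hj ↦ hD j (by omega) (by omega)
    · intro x
      rw [D.exact_succ i x]
      simp

end CoresLE

/-- Each term of the minimal coresolution is controlled by an arbitrary one through
`CoresLE.envelope`. Either side may use a different coresolution for each `n`. -/
theorem gInftyClass_iff [IsSemiprimaryRing R] (s : ℕ) (M : ModuleCat.{u} R) :
    gInftyClass R s M ↔ ∀ n, CoresLE R n s M := by
  constructor
  · intro h n
    obtain ⟨D, hD⟩ := h n
    exact CoresLE.of_coresolution D s n 0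
      (fun j _ hj ↦ (flatDimLE_iff _).1 (hD j (by omega))) D.ι D.ι_injective D.exact_zero
  · intro h n
    exact ⟨minimalInjectiveCoresolution M, fun i _ ↦ (flatDimLE_iff _).2 (CoresLE.pdLE_envelope h i)⟩

/-- Baer's criterion: a map from a finitely generated left ideal meets only finitely many
coordinates, so coordinatewise extensions can be summed. -/
theorem injective_finsupp [IsNoetherianRing R] (ι : Type u) (hE : Module.Injective R E) :
    Module.Injective R (ι →₀ E) := by
  classical
  refine Module.Baer.injective fun I g ↦ ?_
  have hB := Module.Baer.of_injective hE
  obtain ⟨t, ht⟩ : ∃ t : Finset ι, ∀ x : I, (g x).support ⊆ t := by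
    have hI : (⊤ : Submodule R I).FG := Module.Finite.fg_top
    obtain ⟨S, hS⟩ := hI
    refine ⟨S.biUnion fun x ↦ (g x).support, fun x ↦ ?_⟩
    have hx : x ∈ Submodule.span R (S : Set I) := hS ▸ Submodule.mem_top
    have hle : Submodule.span R (S : Set I) ≤ (Finsupp.supported E R
        (↑(S.biUnion fun x ↦ (g x).support) : Set ι)).comap g := by
      rw [Submodule.span_le]
      intro y hy
      rw [SetLike.mem_coe, Submodule.mem_comap, Finsupp.mem_supported]
      exact_mod_cast Finset.subset_biUnion_of_mem (fun x ↦ (g x).support) hy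
    exact_mod_cast (Finsupp.mem_supported R _).1 (hle hx)
  choose φ hφ using fun i ↦ hB I (Finsupp.lapply i ∘ₗ g)
  refine ⟨∑ i ∈ t, Finsupp.lsingle i ∘ₗ φ i, fun x hx ↦ ?_⟩
  ext i
  rw [LinearMap.sum_apply, Finsupp.finsetSum_apply]
  simp only [LinearMap.comp_apply, Finsupp.lsingle_apply, Finsupp.single_apply]
  rw [Finset.sum_ite_eq' t i]
  split_ifs with hi
  · rw [hφ i x hx]
    rfl
  · by_contra h
    exact hi (ht ⟨x, hx⟩ (Finsupp.mem_support_iff.2 (Ne.symm h)))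

theorem CoresLE.finsupp [IsNoetherianRing R] (ι : Type u) {n s : ℕ} (h : CoresLE R n s M) :
    CoresLE R n s (ι →₀ M) := by
  induction n generalizing s M with
  | zero => trivial
  | succ n ih =>
    obtain ⟨E, N, _, _, _, _, f, g, hE, hpd, hfg, hN⟩ := h
    exact ⟨ι →₀ E, ι →₀ N, _, _, _, _, _, _, injective_finsupp ι hE, hpd.finsupp ι,
      isSES_finsupp ι hfg, ih hN⟩

/-- The complement of `P` in the free module on `P` is again projective, so it serves as the
cokernel and the induction on `n` covers it. -/
theorem CoresLE.of_projective [IsNoetherianRing R] (hR : ∀ n, CoresLE R n 0 R) (n : ℕ)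
    [hP : Module.Projective R P] : CoresLE R n 0 P := by
  induction n generalizing P with
  | zero => trivial
  | succ n ih =>
    obtain ⟨i, hi⟩ := Module.projective_lifting_property
      (Finsupp.linearCombination R (id : P → P)) LinearMap.id
      (Finsupp.linearCombination_id_surjective R P)
    have hs := isSES_range (f := i) (Function.LeftInverse.injective
      (g := Finsupp.linearCombination R (id : P → P)) (LinearMap.congr_fun hi))
    obtain ⟨e⟩ := hs.nonempty_prodEquiv_of_retraction _ hi
    have := pdLE_zero_iff.1 (PdLE.of_prodEquiv_right (pdLE_of_projective 0) e)
    exact left_of_isSES hs ((hR _).finsupp P) (ih.mono (by omega))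

/-- Modules of projective dimension at most `s` over a ring satisfying the Auslander condition. -/
theorem CoresLE.of_pdLE [IsNoetherianRing R] (hR : ∀ n, CoresLE R n 0 R) {s : ℕ}
    (hM : PdLE R s M) (n : ℕ) : CoresLE R n s M := by
  induction s generalizing M n with
  | zero =>
    have := pdLE_zero_iff.1 hM
    exact of_projective hR n
  | succ s ih =>
    have hs := isSES_ker (Finsupp.linearCombination_id_surjective R M)
    exact right_of_isSES hs (ih (hs.pdLE_left (pdLE_of_projective s) hM) _)
      ((of_projective hR n).mono (by omega))

/-- The `n`-th cosyzygy has projective dimension at most `g ≤ s + n`; each step back along the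
coresolution lowers the bound by one. -/
theorem CoresLE.pdLE {g : ℕ} (hg : ∀ (X : Type u) [AddCommGroup X] [Module R X], PdLE R g X)
    {n s : ℕ} (h : CoresLE R n s M) (hn : g ≤ s + n) : PdLE R s M := by
  induction n generalizing s M with
  | zero => exact (hg M).mono hn
  | succ n ih =>
    obtain ⟨E, N, _, _, _, _, f, g, hE, hpd, hfg, hN⟩ := h
    exact hfg.pdLE_left hpd (ih hN (by omega))

end Coresolution

/-! ### Projective resolutions with bounded injective dimensions -/

section DualCondition

variable {R : Type u} [Ring R]

variable (R) in
/-- There is an exact sequence `0 → P → Fₘ₋₁ → ⋯ → F₀ → N → 0` with all `Fᵢ` projective and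
`id Fᵢ ≤ t + i`. -/
def ResIdLE (P : Type u) [AddCommGroup P] [Module R P] :
    ℕ → ℕ → ∀ (N : Type u) [AddCommGroup N] [Module R N], Prop
  | 0, _, N, _, _ => Nonempty (P ≃ₗ[R] N)
  | m + 1, t, N, _, _ => ∃ (K F : Type u) (_ : AddCommGroup K) (_ : Module R K)
      (_ : AddCommGroup F) (_ : Module R F) (i : K →ₗ[R] F) (p : F →ₗ[R] N),
      Module.Projective R F ∧ IdLE R t F ∧ IsSES i p ∧ ResIdLE P m (t + 1) K

variable (R) in
/-- Every module of injective dimension at most `i` is a quotient of a projective module of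
injective dimension at most `i`. -/
def CoverIdLE (i : ℕ) : Prop :=
  ∀ (K : Type u) [AddCommGroup K] [Module R K], IdLE R i K →
    ∃ (Y : Type u) (_ : AddCommGroup Y) (_ : Module R Y) (p : Y →ₗ[R] K),
      Module.Projective R Y ∧ IdLE R i Y ∧ Function.Surjective p

variable {A B C E K M N N' P : Type u} [AddCommGroup A] [Module R A] [AddCommGroup B] [Module R B]
  [AddCommGroup C] [Module R C] [AddCommGroup E] [Module R E] [AddCommGroup K] [Module R K]
  [AddCommGroup M] [Module R M] [AddCommGroup N] [Module R N] [AddCommGroup N'] [Module R N']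
  [AddCommGroup P] [Module R P]

/-- The horseshoe lemma. The resolution of `A` ends in zero, so the end term `P` survives unchanged.
-/
theorem ResIdLE.of_isSES {α : A →ₗ[R] B} {β : B →ₗ[R] C} (h : IsSES α β) {m t t' : ℕ}
    (htt : t' ≤ t) (hA : ResIdLE R PUnit.{u + 1} m t A) (hC : ResIdLE R P m t' C) :
    ResIdLE R P m t B := by
  induction m generalizing A B C t t' with
  | zero =>
    obtain ⟨e⟩ := hA
    obtain ⟨e'⟩ := hC
    have : Subsingleton A := e.symm.toEquiv.subsingleton
    have hβ : Function.Injective β := (injective_iff_map_eq_zero β).2 fun b hb ↦ by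
      obtain ⟨a, rfl⟩ := (h.exact b).1 hb
      rw [Subsingleton.elim a 0, map_zero]
    exact ⟨e'.trans (LinearEquiv.ofBijective β ⟨hβ, h.surj⟩).symm⟩
  | succ m ih =>
    obtain ⟨K, F, _, _, _, _, i, p, hF, hid, hip, hK⟩ := hA
    obtain ⟨K', F', _, _, _, _, i', p', hF', hid', hip', hK'⟩ := hC
    obtain ⟨π, φ, ψ, hπ, hφψ⟩ := h.horseshoe hip hip'
    exact ⟨LinearMap.ker π, F × F', _, _, _, _, _, π, inferInstance,
      hid.prod (hid'.mono htt), isSES_ker hπ, ih hφψ (by omega) hK hK'⟩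

/-- Iterating the covers raises the bound on the injective dimension of the kernel by one and lowers
that on its projective dimension by one, so after `r` steps the kernel is itself projective. -/
theorem ResIdLE.of_pdLE {r t : ℕ} (hD : ∀ j < t + r, CoverIdLE R j) (hid : IdLE R t K)
    (hpd : PdLE R r K) : ResIdLE R PUnit.{u + 1} (r + 1) t K := by
  induction r generalizing t K with
  | zero =>
    have := pdLE_zero_iff.1 hpd
    exact ⟨PUnit, K, _, _, _, _, 0, LinearMap.id, this, hid,
      ⟨fun _ _ _ ↦ Subsingleton.elim _ _, Function.surjective_id,
        fun x ↦ ⟨fun h ↦ ⟨0, h.symm⟩, by rintro ⟨_, rfl⟩; rfl⟩⟩, ⟨.refl R _⟩⟩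
  | succ r ih =>
    obtain ⟨Y, _, _, p, hY, hYid, hp⟩ := hD t (by omega) K hid
    have hs := isSES_ker hp
    exact ⟨_, Y, _, _, _, _, _, p, hY, hYid, hs, ih (fun j hj ↦ hD j (by omega))
      (hs.idLE_left (hYid.mono (by omega)) hid) (hs.pdLE_left (pdLE_of_projective r) hpd)⟩

/-- Let `F → E` begin a resolution of `E`, with kernel `K`. The kernel of `F → E → N'` is an
extension of `N` by `K`, resolved by the horseshoe, so `N'` gets a resolution one term longer with
the same end `P`. -/
theorem ResIdLE.cosyzygy {m : ℕ} (hD : ∀ j < m, CoverIdLE R j) (hN : ResIdLE R P m 0 N)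
    {f : N →ₗ[R] E} {g : E →ₗ[R] N'} (h : IsSES f g) (hE : Module.Injective R E)
    (hpd : PdLE R m E) : ResIdLE R P (m + 1) 0 N' := by
  obtain ⟨K, F, _, _, _, _, i, p, hF, hid, hip, hK⟩ :=
    ResIdLE.of_pdLE (t := 0) (by simpa using hD) (idLE_zero_iff.2 hE) hpd
  have hgp : Function.Surjective (g ∘ₗ p) := h.surj.comp hip.surj
  refine ⟨LinearMap.ker (g ∘ₗ p), F, _, _, _, _, _, g ∘ₗ p, hF, hid, isSES_ker hgp, ?_⟩
  let φ : K →ₗ[R] LinearMap.ker (g ∘ₗ p) := i.codRestrict _ fun k ↦ by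
    simp [hip.apply_apply_eq_zero]
  let ψ : LinearMap.ker (g ∘ₗ p) →ₗ[R] N :=
    h.lift (p ∘ₗ (LinearMap.ker (g ∘ₗ p)).subtype) (by ext x; exact x.2)
  have hψ (x) : f (ψ x) = p x := h.apply_lift _ _ _
  refine ResIdLE.of_isSES (α := φ) (β := ψ) ⟨?_, ?_, ?_⟩ (Nat.zero_le _) hK hN
  · exact fun k k' hk ↦ hip.inj (congrArg Subtype.val hk)
  · intro n
    obtain ⟨x, hx⟩ := hip.surj (f n)
    exact ⟨⟨x, by simp [hx, h.apply_apply_eq_zero]⟩, h.inj (by rw [hψ, hx])⟩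
  · intro x
    constructor
    · intro hx
      obtain ⟨k, hk⟩ := (hip.exact (x : F)).1 (by rw [← hψ, hx, map_zero])
      exact ⟨k, Subtype.ext hk⟩
    · rintro ⟨k, rfl⟩
      exact h.inj (by rw [hψ, map_zero]; exact hip.apply_apply_eq_zero k)

/-- For `m = 0` and `N = P` this turns `n` steps of an injective coresolution of `P` into `n` steps
of a coresolution by projectives of bounded injective dimension. -/
theorem ResIdLE.of_coresLE {m n : ℕ} (hD : ∀ j, j + 1 < m + n → CoverIdLE R j)
    (hN : ResIdLE R P m 0 N) (hc : CoresLE R n m N) :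
    ∃ (N' : Type u) (_ : AddCommGroup N') (_ : Module R N'), ResIdLE R P (m + n) 0 N' := by
  induction n generalizing m N with
  | zero => exact ⟨N, _, _, hN⟩
  | succ n ih =>
    obtain ⟨E, N', _, _, _, _, f, g, hE, hpd, hfg, hN'⟩ := hc
    have := ih (m := m + 1) (fun j hj ↦ hD j (by omega))
      (hN.cosyzygy (fun j hj ↦ hD j (by omega)) hfg hE hpd) hN'
    rwa [show m + 1 + n = m + (n + 1) by omega] at this

theorem ResIdLE.exists_left {m t : ℕ} (hN : ResIdLE R P (m + 1) t N) :
    ∃ (F C : Type u) (_ : AddCommGroup F) (_ : Module R F) (_ : AddCommGroup C) (_ : Module R C)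
      (a : P →ₗ[R] F) (b : F →ₗ[R] C), Module.Projective R F ∧ IdLE R (t + m) F ∧ IsSES a b ∧
      ResIdLE R C m t N := by
  induction m generalizing t N with
  | zero =>
    obtain ⟨K, F, _, _, _, _, i, p, hF, hid, hip, ⟨e⟩⟩ := hN
    exact ⟨F, N, _, _, _, _, _, p, hF, hid, hip.comp_equiv e, ⟨.refl R N⟩⟩
  | succ m ih =>
    obtain ⟨K, F, _, _, _, _, i, p, hF, hid, hip, hK⟩ := hN
    obtain ⟨F', C, _, _, _, _, a, b, hF', hid', hab, hC⟩ := ih hK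
    exact ⟨F', C, _, _, _, _, a, b, hF', by rwa [show t + 1 + m = t + (m + 1) by omega] at hid',
      hab, K, F, _, _, _, _, i, p, hF, hid, hip, hC⟩

/-- Dimension shifting: `C` is an `n`-th syzygy of `N`, so the group embeds in `Ext^{n+j+1}(N, K)`.
-/
theorem ResIdLE.ext_eq_zero {n j t : ℕ} (hC : ResIdLE R C n t N) (hK : IdLE R (n + j) K)
    (x : Abelian.Ext (ModuleCat.of R C) (ModuleCat.of R K) (j + 1)) : x = 0 := by
  induction n generalizing C j with
  | zero =>
    rw [Nat.zero_add] at hK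
    have : HasInjectiveDimensionLT (ModuleCat.of R K) (j + 1) := hK
    exact x.eq_zero_of_hasInjectiveDimensionLT (j + 1) le_rfl
  | succ n ih =>
    obtain ⟨F, C', _, _, _, _, a, b, hF, -, hab, hC'⟩ := hC.exists_left
    exact hab.ext_eq_zero hF j
      (ih hC' (by rwa [show n + (j + 1) = n + 1 + j by omega])) x

theorem ResIdLE.coresLE [IsNoetherianRing R] (hR : ∀ n, CoresLE R n 0 R) {n t : ℕ}
    (hC : ResIdLE R C n t N) : CoresLE R n 0 C := by
  induction n generalizing C with
  | zero => trivial
  | succ n ih =>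
    obtain ⟨F, C', _, _, _, _, a, b, hF, -, hab, hC'⟩ := hC.exists_left
    exact CoresLE.left_of_isSES hab (CoresLE.of_projective hR _) ((ih hC').mono (by omega))

/-- With `i + 1` steps, the projective next to `P` has injective dimension at most `i`, and its
cokernel `C` is an `i`-th syzygy. -/
theorem exists_projective_embedding [IsNoetherianRing R] (hR : ∀ n, CoresLE R n 0 R) {i : ℕ}
    (hD : ∀ j < i, CoverIdLE R j) (P : Type u) [AddCommGroup P] [Module R P]
    [Module.Projective R P] :
    ∃ (Y C N : Type u) (_ : AddCommGroup Y) (_ : Module R Y) (_ : AddCommGroup C) (_ : Module R C)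
      (_ : AddCommGroup N) (_ : Module R N)
      (a : P →ₗ[R] Y) (b : Y →ₗ[R] C), Module.Projective R Y ∧ IdLE R i Y ∧ IsSES a b ∧
      ResIdLE R C i 0 N := by
  obtain ⟨N, _, _, hN⟩ := ResIdLE.of_coresLE (m := 0) (n := i + 1) (P := P) (N := P)
    (fun j hj ↦ hD j (by omega)) ⟨.refl R P⟩ (CoresLE.of_projective hR _)
  rw [Nat.zero_add] at hN
  obtain ⟨Y, C, _, _, _, _, a, b, hY, hid, hab, hC⟩ := hN.exists_left
  rw [Nat.zero_add] at hid
  exact ⟨Y, C, N, _, _, _, _, _, _, a, b, hY, hid, hab, hC⟩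

/-- The dual of the Auslander condition. -/
theorem coverIdLE [IsNoetherianRing R] (hR : ∀ n, CoresLE R n 0 R) (i : ℕ) : CoverIdLE R i := by
  induction i using Nat.strong_induction_on with
  | _ i ih =>
    intro K _ _ hK
    obtain ⟨Y, C, N, _, _, _, _, _, _, a, b, hY, hid, hab, hC⟩ :=
      exists_projective_embedding hR ih (K →₀ R)
    -- As `C` is an `i`-th syzygy and `id K ≤ i`, `Ext¹(C, K)` vanishes: the free cover of `K`
    -- extends to `Y`, and the extension stays surjective.
    obtain ⟨ψ, hψ⟩ := hab.exists_extension (hC.ext_eq_zero (j := 0) hK)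
      (Finsupp.linearCombination R id)
    refine ⟨Y, _, _, ψ, hY, hid, ?_⟩
    have := Finsupp.linearCombination_id_surjective R K
    rw [← hψ] at this
    exact Function.Surjective.of_comp this

/-! ### Finite self-injective dimension -/

/-- A section of the free cover writes `y` as a combination whose coefficients are functionals
evaluated at `y`. These lie in the right ideal generated by `T`, so elements of `T` can be pulled
out on the left. -/
theorem exists_sum_smul_eq {Y : Type u} [AddCommGroup Y] [Module R Y] [hY : Module.Projective R Y]
    (y : Y) (T : Finset R)
    (hT : ∀ f : Y →ₗ[R] R, f y ∈ Submodule.span Rᵐᵒᵖ (T : Set R)) :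
    ∃ v : R → Y, ∑ a ∈ T, a • v a = y := by
  obtain ⟨s, hs⟩ := hY.out
  have key (c : R) (hc : c ∈ Submodule.span Rᵐᵒᵖ (T : Set R)) (z : Y) :
      ∃ v : R → Y, ∑ a ∈ T, a • v a = c • z := by
    obtain ⟨b, -, rfl⟩ := Submodule.mem_span_finset.1 hc
    refine ⟨fun a ↦ (b a).unop • z, ?_⟩
    rw [Finset.sum_smul]
    refine Finset.sum_congr rfl fun a _ ↦ ?_
    rw [← mul_smul]
    rfl
  rw [← hs y, Finsupp.linearCombination_apply, Finsupp.sum]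
  refine Finset.sum_induction _ (fun w ↦ ∃ v : R → Y, ∑ a ∈ T, a • v a = w) ?_ ?_ ?_
  · rintro _ _ ⟨v, rfl⟩ ⟨w, rfl⟩
    exact ⟨v + w, by simp [Finset.sum_add_distrib]⟩
  · exact ⟨0, by simp⟩
  · exact fun z _ ↦ key _ (hT (Finsupp.lapply z ∘ₗ s)) _

/-- If `u : A → Y` factors as `g ∘ h`, then `coker h` inherits coresolutions from `coker u`. -/
theorem coresLE_of_factorization [IsNoetherianRing R] (hR : ∀ n, CoresLE R n 0 R)
    {Q Y L : Type u} [AddCommGroup Q] [Module R Q] [AddCommGroup Y] [Module R Y]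
    [AddCommGroup L] [Module R L] [Module.Projective R Q] [Module.Projective R Y]
    {u : A →ₗ[R] Y} {b : Y →ₗ[R] C} (hub : IsSES u b) {h : A →ₗ[R] Q} {q : Q →ₗ[R] L}
    (hhq : IsSES h q) (g : Q →ₗ[R] Y) (hg : g ∘ₗ h = u) {n : ℕ} (hC : CoresLE R n 0 C) :
    CoresLE R n 0 L := by
  have hg' (x) : g (h x) = u x := LinearMap.congr_fun hg x
  let δ : L →ₗ[R] C := hhq.desc (b ∘ₗ g) (by ext x; simp [hg', hub.apply_apply_eq_zero])
  have hδ (x) : δ (q x) = b (g x) := hhq.desc_apply _ _ _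
  -- The sequence `0 → Q → Y × L → C → 0` coresolves `Y × L`, and `L` is the kernel of the
  -- projection onto the projective `Y`.
  have hs : IsSES (g.prod q) (b.coprod (-δ)) := by
    refine ⟨?_, ?_, ?_⟩
    · rw [injective_iff_map_eq_zero]
      intro x hx
      obtain ⟨h1, h2⟩ : g x = 0 ∧ q x = 0 := by simpa using hx
      obtain ⟨a, rfl⟩ := (hhq.exact x).1 h2
      have : a = 0 := hub.inj (by rw [← hg', h1, map_zero])
      simp [this]
    · intro c
      obtain ⟨y, rfl⟩ := hub.surj c
      exact ⟨(y, 0), by simp⟩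
    · rintro ⟨y, l⟩
      obtain ⟨x, rfl⟩ := hhq.surj l
      constructor
      · intro hx
        have h1 : b (y - g x) = 0 := by simpa [hδ, sub_eq_add_neg] using hx
        obtain ⟨a, ha⟩ := (hub.exact _).1 h1
        refine ⟨x + h a, ?_⟩
        simp [hg', ha, hhq.apply_apply_eq_zero]
      · rintro ⟨x', hx'⟩
        obtain ⟨rfl, h2⟩ : g x' = y ∧ q x' = q x := by simpa using hx'
        simp [← h2, hδ]
  have hYL := CoresLE.of_isSES hs (CoresLE.of_projective hR n) hC
  cases n with
  | zero => trivial
  | succ n =>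
    exact CoresLE.left_of_isSES isSES_prod' hYL ((CoresLE.of_projective hR n).mono (by omega))

/-- If all finitely generated modules satisfying the Auslander condition are projective, then the
ring has finite self-injective dimension. -/
theorem exists_idLE_self [IsNoetherianRing R] [IsNoetherianRing Rᵐᵒᵖ]
    (hR : ∀ n, CoresLE R n 0 R)
    (h3 : ∀ (L : Type u) [AddCommGroup L] [Module R L] [Module.Finite R L],
      (∀ n, CoresLE R n 0 L) → Module.Projective R L) : ∃ d, IdLE R d R := by
  choose Y C N _ _ _ _ _ _ u b hY hid hub hC using fun i ↦
    exists_projective_embedding hR (i := i) (fun j _ ↦ coverIdLE hR j) R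
  -- `S` collects the coordinates of all `uᵢ(1)`. Finitely many generate the same right ideal, so
  -- the map `h` formed from these lets every `uⱼ` factor through one finite free module.
  let S : Set R := {r | ∃ (i : ℕ) (f : Y i →ₗ[R] R), f (u i 1) = r}
  have : IsNoetherian Rᵐᵒᵖ R :=
    isNoetherian_of_linearEquiv (MulOpposite.opLinearEquiv Rᵐᵒᵖ : R ≃ₗ[Rᵐᵒᵖ] Rᵐᵒᵖ).symm
  obtain ⟨T, hTS, hT⟩ := Submodule.fg_span_iff_fg_span_finset_subset (R := Rᵐᵒᵖ) S |>.1
    (IsNoetherian.noetherian _)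
  choose i f hf using fun a : T ↦ hTS a.2
  let h : R →ₗ[R] (T → R) := LinearMap.pi fun a ↦ LinearMap.toSpanSingleton R R (a : R)
  have hfac (j : ℕ) : ∃ g : (T → R) →ₗ[R] Y j, g ∘ₗ h = u j := by
    obtain ⟨v, hv⟩ := exists_sum_smul_eq (u j 1) T fun f ↦ by
      rw [← hT]
      exact Submodule.subset_span ⟨j, f, rfl⟩
    refine ⟨∑ a : T, LinearMap.toSpanSingleton R (Y j) (v a) ∘ₗ LinearMap.proj a, ?_⟩
    ext
    rw [← hv, ← Finset.sum_coe_sort T]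
    simp [h]
  choose g hg using hfac
  have hinj : Function.Injective h := by
    have : Function.Injective (g 0 ∘ₗ h) := hg 0 ▸ (hub 0).inj
    exact Function.Injective.of_comp this
  have hs := isSES_range hinj
  -- The factorization of `uₙ` provides `n` steps of a coresolution of `coker h`; all `n` are
  -- available because `h` serves every `uₙ`.
  have hL := h3 ((T → R) ⧸ LinearMap.range h) fun n ↦
    coresLE_of_factorization hR (hub n) hs (g n) (hg n) ((hC n).coresLE hR)
  obtain ⟨r, hr⟩ := hs.exists_retraction
  let d := Finset.univ.sup i
  have hd : IdLE R d (∀ a : T, Y (i a)) :=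
    IdLE.pi fun a ↦ (hid (i a)).mono (Finset.le_sup (Finset.mem_univ a))
  -- Each coordinate of `h` is a functional applied to some `uᵢ`, so `h` factors through the product
  -- of the `Y (i a)`, and a retraction of `h` makes `R` a summand of it.
  refine ⟨d, hd.retract (LinearMap.pi fun a ↦ u (i a))
    (r ∘ₗ LinearMap.pi fun a ↦ f a ∘ₗ LinearMap.proj a) ?_⟩
  rw [← hr, LinearMap.comp_assoc]
  congr 1
  ext a
  simpa [h] using hf a

end DualCondition

/-! ### Finiteness of injective envelopes over Artin algebras -/

section ArtinAlgebra

variable {R : Type u} [Ring R]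

/-- The elements killed by the Jacobson radical lie in every essential submodule. -/
theorem IsEssential.mem_of_jacobson_smul [IsSemiprimaryRing R] {E : Type u} [AddCommGroup E]
    [Module R E] {K : Submodule R E} (hK : IsEssential K) {x : E}
    (hx : ∀ r ∈ Ring.jacobson R, r • x = 0) : x ∈ K := by
  let T : Submodule R E :=
    { carrier := {x | ∀ r ∈ Ring.jacobson R, r • x = 0}
      add_mem' := fun ha hb r hr ↦ by rw [smul_add, ha r hr, hb r hr, add_zero]
      zero_mem' := fun r _ ↦ smul_zero r
      smul_mem' := fun s a ha r hr ↦ by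
        rw [← mul_smul]
        exact ha _ (Ideal.mul_mem_right _ _ hr) }
  -- In the semisimple module `T`, a complement of `K ∩ T` misses the essential submodule `K`, hence
  -- is zero.
  have : IsSemisimpleModule R T := isSemisimpleModule_of_jacobson_smul fun a r ↦
    Subtype.ext (a.2 r r.2)
  obtain ⟨C, hC⟩ := exists_isCompl (K.comap T.subtype)
  have h1 : C.map T.subtype = ⊥ := by
    refine hK _ ?_
    rw [eq_bot_iff]
    rintro _ ⟨⟨c, hc, rfl⟩, hcK⟩
    have : c ∈ K.comap T.subtype ⊓ C := ⟨hcK, hc⟩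
    rw [hC.inf_eq_bot] at this
    simp [(Submodule.mem_bot R).1 this]
  have h2 : C = ⊥ :=
    Submodule.map_injective_of_injective T.injective_subtype (h1.trans (Submodule.map_bot _).symm)
  have h3 := hC.sup_eq_top
  rw [h2, sup_bot_eq] at h3
  have h4 : (⟨x, hx⟩ : T) ∈ K.comap T.subtype := h3 ▸ Submodule.mem_top
  exact h4

/-- Over an Artin algebra, essential extensions of finitely generated modules are finitely
generated. -/
theorem IsEssential.finite (k : Type v) [CommRing k] [IsArtinianRing k] [Algebra k R]
    [Module.Finite k R] [IsSemiprimaryRing R] {E : Type u} [AddCommGroup E] [Module R E]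
    {K : Submodule R E} (hK : IsEssential K) (hfg : K.FG) : Module.Finite R E := by
  let _ : Module k E := Module.compHom E (algebraMap k R)
  have : IsScalarTower k R E := ⟨fun c r x ↦ by
    change (c • r) • x = algebraMap k R c • r • x
    rw [Algebra.smul_def, mul_smul]⟩
  have hKk : (K.restrictScalars k).FG := by
    have : Module.Finite R K := Module.Finite.iff_fg.2 hfg
    have : Module.Finite k K := Module.Finite.trans R K
    exact Module.Finite.iff_fg.1 this
  let J := Ring.jacobson R
  -- The annihilators of `J ^ i` exhaust `E` since `J` is nilpotent. Generators of `J ^ i` over `k`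
  -- send `T (i + 1)` into the part killed by `J`, which lies in `K`, with kernel inside `T i`.
  let T (i : ℕ) : Submodule k E :=
    { carrier := {x | ∀ r ∈ J ^ i, r • x = 0}
      add_mem' := fun ha hb r hr ↦ by rw [smul_add, ha r hr, hb r hr, add_zero]
      zero_mem' := fun r _ ↦ smul_zero r
      smul_mem' := fun c a ha r hr ↦ by rw [smul_comm, ha r hr, smul_zero] }
  have hT (i : ℕ) : (T i).FG := by
    induction i with
    | zero =>
      have : T 0 = ⊥ := by
        rw [eq_bot_iff]
        intro x hx
        simpa using hx 1 (by simp [Submodule.pow_zero, Ideal.one_eq_top])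
      rw [this]
      exact Submodule.fg_bot
    | succ i ih =>
      obtain ⟨G, hG⟩ : ((J ^ i).restrictScalars k).FG := IsNoetherian.noetherian _
      have hGJ (a : G) : (a : R) ∈ J ^ i := by
        have : (a : R) ∈ (J ^ i).restrictScalars k := hG ▸ Submodule.subset_span a.2
        exact this
      let f : E →ₗ[k] (G → E) := LinearMap.pi fun a ↦ Module.toModuleEnd k E (a : R)
      refine Submodule.fg_of_fg_map_of_fg_inf_ker f ?_ ?_
      · have hpi : (Submodule.pi Set.univ fun _ : G ↦ K.restrictScalars k).FG :=
          Submodule.fg_pi fun _ ↦ hKk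
        refine hpi.of_le ?_
        rintro _ ⟨x, hx, rfl⟩ a -
        refine hK.mem_of_jacobson_smul fun r hr ↦ ?_
        change r • (a : R) • x = 0
        rw [← mul_smul]
        refine hx _ ?_
        rw [Ideal.IsTwoSided.pow_succ]
        exact Ideal.mul_mem_mul hr (hGJ a)
      · refine ih.of_le ?_
        rintro x ⟨-, hx⟩ r hr
        have hr' : r ∈ Submodule.span k (G : Set R) := hG.symm ▸ hr
        clear hr
        induction hr' using Submodule.span_induction with
        | mem a ha => exact congrFun hx ⟨a, ha⟩
        | zero => exact zero_smul R x
        | add a b _ _ ha hb => rw [add_smul, ha, hb, add_zero]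
        | smul c a _ ha => rw [smul_assoc, ha, smul_zero]
  obtain ⟨n, hn⟩ := IsSemiprimaryRing.isNilpotent (R := R)
  have htop : T n = ⊤ := by
    rw [eq_top_iff]
    intro x _ r hr
    rw [show J ^ n = 0 from hn] at hr
    simp [(Submodule.mem_bot R).1 hr]
  have : Module.Finite k E := ⟨htop ▸ hT n⟩
  exact Module.Finite.of_restrictScalars_finite k R E

/-! ### Simple modules -/

variable (R) in
/-- A complete irredundant family of simple modules. -/
structure SimpleFamily (ι : Type) where
  /-- the modules -/
  S : ι → ModuleCat.{u} R
  simple : ∀ i, IsSimpleModule R (S i)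
  eq_of_equiv : ∀ i j, Nonempty (S i ≃ₗ[R] S j) → i = j
  exists_equiv : ∀ (M : Type u) [AddCommGroup M] [Module R M] [IsSimpleModule R M],
    ∃ i, Nonempty (S i ≃ₗ[R] M)

-- A nonzero element of a simple module gives a nonzero map from `R/J`, so the module is one of the
-- finitely many simple summands of `R/J`.
variable (R) in
theorem exists_simpleFamily [IsArtinianRing R] :
    ∃ (ι : Type) (_ : Finite ι), Nonempty (SimpleFamily R ι) := by
  have : IsSemisimpleModule R (R ⧸ Ring.jacobson R) :=
    isSemisimpleModule_of_jacobson_smul <| (Module.isTorsionBySet_quotient_iff _ _).2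
      fun m i hi ↦ Ideal.mul_mem_right _ _ hi
  obtain ⟨n, T, e, hT⟩ := IsSemisimpleModule.exists_linearEquiv_fin_dfinsupp R (R ⧸ Ring.jacobson R)
  let r : Setoid (Fin n) :=
    { r := fun i j ↦ Nonempty (T i ≃ₗ[R] T j)
      iseqv := ⟨fun i ↦ ⟨.refl R _⟩, fun ⟨e⟩ ↦ ⟨e.symm⟩, fun ⟨e⟩ ⟨e'⟩ ↦ ⟨e.trans e'⟩⟩ }
  refine ⟨Quotient r, inferInstance, ⟨⟨fun q ↦ ModuleCat.of R (T q.out), fun q ↦ hT q.out,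
    fun i j h ↦ ?_, fun M _ _ _ ↦ ?_⟩⟩⟩
  · rw [← i.out_eq, ← j.out_eq]
    exact Quotient.sound h
  · have := IsSimpleModule.nontrivial R M
    obtain ⟨m, hm⟩ := exists_ne (0 : M)
    let f : R ⧸ Ring.jacobson R →ₗ[R] M := (Ring.jacobson R).liftQ
      (LinearMap.toSpanSingleton R M m) fun r hr ↦ by
        simpa using Module.mem_annihilator.1
          (IsSemisimpleModule.jacobson_le_annihilator R M hr) m
    have hf : f (Submodule.Quotient.mk 1) = m := one_smul R m
    have hex : ∃ i, f ∘ₗ e.symm.toLinearMap ∘ₗ DFinsupp.lsingle i ≠ 0 := by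
      by_contra! h
      have h0 : f ∘ₗ e.symm.toLinearMap = 0 := DFinsupp.lhom_ext' h
      have := LinearMap.congr_fun h0 (e (Submodule.Quotient.mk 1))
      rw [LinearMap.comp_apply, LinearEquiv.coe_coe, e.symm_apply_apply, hf] at this
      exact hm this
    obtain ⟨i, hi⟩ := hex
    have := hT i
    let e1 := LinearEquiv.ofBijective _ (LinearMap.bijective_of_ne_zero hi)
    obtain ⟨e2⟩ : Nonempty (T (Quotient.mk r i).out ≃ₗ[R] T i) := Quotient.mk_out (s := r) i
    exact ⟨Quotient.mk r i, ⟨e2.trans e1⟩⟩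

namespace SimpleFamily

variable {ι : Type} (𝒮 : SimpleFamily R ι)

instance (i : ι) : IsSimpleModule R (𝒮.S i) := 𝒮.simple i

/-- Otherwise `S i` is a quotient, hence a summand, of the semisimple module `R/I`, where `I`
annihilates all other simples. Some `S j` with `j ≠ i` then receives a nonzero map from `S i`,
contradicting irredundancy. -/
theorem exists_smul_ne_zero [IsArtinianRing R] (i : ι) :
    ∃ r : R, (∀ j, j ≠ i → ∀ v : 𝒮.S j, r • v = 0) ∧ ∃ v : 𝒮.S i, r • v ≠ 0 := by
  by_contra! h
  let I : Ideal R := ⨅ j : {j // j ≠ i}, Module.annihilator R (𝒮.S j)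
  have hI (r : R) : r ∈ I ↔ ∀ j, j ≠ i → ∀ v : 𝒮.S j, r • v = 0 := by
    simp [I, Submodule.mem_iInf, Module.mem_annihilator]
  have hJ : Ring.jacobson R ≤ I := le_iInf fun j ↦
    IsSemisimpleModule.jacobson_le_annihilator R (𝒮.S j)
  have : IsSemisimpleModule R (R ⧸ I) := by
    refine isSemisimpleModule_of_jacobson_smul <| (Module.isTorsionBySet_quotient_iff _ _).2
      fun m r hr ↦ hJ (Ideal.mul_mem_right _ _ hr)
  have := IsSimpleModule.nontrivial R (𝒮.S i)
  obtain ⟨s, hs⟩ := exists_ne (0 : 𝒮.S i)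
  let f : R ⧸ I →ₗ[R] 𝒮.S i := I.liftQ (LinearMap.toSpanSingleton R _ s) fun r hr ↦ by
    simpa using h r ((hI r).1 hr) s
  have hf1 : f (Submodule.Quotient.mk 1) = s := one_smul R s
  have hf : Function.Surjective f := LinearMap.surjective_of_ne_zero fun h0 ↦ hs (by
    rw [← hf1, h0, LinearMap.zero_apply])
  obtain ⟨σ, hσ⟩ := IsSemisimpleModule.lifting_property f hf LinearMap.id
  obtain ⟨r, hr⟩ := Submodule.Quotient.mk_surjective I (σ s)
  have hrI : r ∉ I := fun hr' ↦ hs (by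
    rw [(Submodule.Quotient.mk_eq_zero I).2 hr'] at hr
    have := LinearMap.congr_fun hσ s
    rw [LinearMap.comp_apply, ← hr, map_zero] at this
    exact this.symm)
  rw [hI] at hrI
  push Not at hrI
  obtain ⟨j, hj, v, hv⟩ := hrI
  let g : R ⧸ I →ₗ[R] 𝒮.S j := I.liftQ (LinearMap.toSpanSingleton R _ v) fun r hr ↦ by
    simpa using (hI r).1 hr j hj v
  have hg : (g ∘ₗ σ) s = r • v := by
    rw [LinearMap.comp_apply, ← hr]
    rfl
  refine hj (𝒮.eq_of_equiv i j ⟨LinearEquiv.ofBijective (g ∘ₗ σ)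
    (LinearMap.bijective_of_ne_zero fun h0 ↦ hv ?_)⟩).symm
  rw [← hg, h0, LinearMap.zero_apply]

/-- For each simple module of the family there is a projective module that maps nontrivially to
this simple module only. -/
theorem exists_projective [IsArtinianRing R] (i : ι) :
    ∃ (P : Type u) (_ : AddCommGroup P) (_ : Module R P), Module.Projective R P ∧
      Module.Finite R P ∧ (∀ j, j ≠ i → ∀ f : P →ₗ[R] 𝒮.S j, f = 0) ∧
      ∃ f : P →ₗ[R] 𝒮.S i, f ≠ 0 := by
  obtain ⟨a, ha, v, hv⟩ := 𝒮.exists_smul_ne_zero i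
  obtain ⟨b, hb⟩ := IsSimpleModule.toSpanSingleton_surjective R hv v
  have hx : (b * a) • v = v := by
    rw [mul_smul]
    exact hb
  have hv0 : v ≠ 0 := fun h ↦ hv (by rw [h, smul_zero])
  let φ : Module.End R R := LinearMap.toSpanSingleton R R (b * a)
  have hφ (n : ℕ) (r : R) : (φ ^ n) r = r * (b * a) ^ n := by
    induction n generalizing r with
    | zero => simp
    | succ n ih =>
      rw [pow_succ, Module.End.mul_apply, ih, pow_succ']
      simp [φ, mul_assoc]
  have hxn (n : ℕ) : (b * a) ^ n • v = v := by
    induction n with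
    | zero => simp
    | succ n ih => rw [pow_succ, mul_smul, hx, ih]
  -- Fitting's lemma for right multiplication by `b * a`: the stable image is a summand of `R`. It
  -- maps nontrivially to `S i` because `b * a` fixes `v`; since `n ≥ 1`, a factor `a` kills its
  -- maps to the other simples.
  obtain ⟨n, hn, hn1⟩ := (φ.eventually_isCompl_ker_pow_range_pow.and
    (Filter.eventually_ge_atTop 1)).exists
  let P := LinearMap.range (φ ^ n)
  let ρ : R →ₗ[R] P := P.projectionOnto _ hn.symm
  have hρ (p : P) : ρ p = p := Submodule.projectionOnto_apply_left hn.symm p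
  refine ⟨P, _, _, ?_, inferInstance, fun j hj f ↦ ?_, ?_⟩
  · exact Module.Projective.of_split P.subtype ρ (LinearMap.ext hρ)
  · ext ⟨p, r, rfl⟩
    have h1 : f ⟨(φ ^ n) r, r, rfl⟩ = (f ∘ₗ ρ) ((φ ^ n) r) := by
      rw [LinearMap.comp_apply]
      exact congrArg f (hρ ⟨(φ ^ n) r, r, rfl⟩).symm
    rw [LinearMap.zero_apply]
    refine h1.trans ?_
    rw [hφ, ← mul_one (r * _), ← smul_eq_mul, map_smul]
    obtain ⟨m, rfl⟩ : ∃ m, n = m + 1 := ⟨n - 1, by omega⟩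
    rw [pow_succ, ← mul_assoc, ← mul_assoc, mul_smul, ha j hj, smul_zero]
  · refine ⟨LinearMap.toSpanSingleton R _ v ∘ₗ P.subtype, fun h0 ↦ hv0 ?_⟩
    have := LinearMap.congr_fun h0 ⟨(φ ^ n) 1, 1, rfl⟩
    simpa [hφ, hxn] using this

end SimpleFamily

/-- A simple module over an Artin algebra is finite over its endomorphism ring. -/
theorem finite_end (k : Type v) [CommRing k] [Algebra k R] [Module.Finite k R] (S : Type u)
    [AddCommGroup S] [Module R S] [Module.Finite R S] : Module.Finite (Module.End R S) S := by
  let _ : Module k S := Module.compHom S (algebraMap k R)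
  have : IsScalarTower k R S := ⟨fun c r x ↦ by
    change (c • r) • x = algebraMap k R c • r • x
    rw [Algebra.smul_def, mul_smul]⟩
  have : Module.Finite k S := Module.Finite.trans R S
  have : IsScalarTower k (Module.End R S) S := ⟨fun c f x ↦ rfl⟩
  exact Module.Finite.of_restrictScalars_finite k (Module.End R S) S

theorem finite_hom_simple (P S : Type u) [AddCommGroup P] [Module R P] [Module.Finite R P]
    [AddCommGroup S] [Module R S] [IsSimpleModule R S] [Module.Finite (Module.End R S) S] :
    Module.Finite (Module.End R S) (P →ₗ[R] S) := by
  classical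
  obtain ⟨n, f, hf⟩ := Module.Finite.exists_fin' R P
  let g : (P →ₗ[R] S) →ₗ[Module.End R S] (Fin n → S) :=
    { toFun := fun φ i ↦ φ (f (Pi.single i 1))
      map_add' := fun _ _ ↦ rfl
      map_smul' := fun _ _ ↦ rfl }
  have : IsNoetherianRing (Module.End R S) := inferInstance
  refine Module.Finite.of_injective g fun φ ψ h ↦ ?_
  have : φ ∘ₗ f = ψ ∘ₗ f := LinearMap.pi_ext' fun i ↦ LinearMap.ext_ring (congrFun h i)
  exact LinearMap.ext fun x ↦ by
    obtain ⟨y, rfl⟩ := hf x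
    exact LinearMap.congr_fun this y

end ArtinAlgebra

/-! ### Euler characteristics of modules of finite projective dimension -/

section Euler

variable {R : Type u} [Ring R] {ι : Type} (𝒮 : SimpleFamily R ι)

namespace SimpleFamily

/-- The dimensions of the spaces of maps to the simple modules over their endomorphism rings. -/
noncomputable def topRank (P : Type u) [AddCommGroup P] [Module R P] : ι → ℚ := fun i ↦
  Module.finrank (Module.End R (𝒮.S i)) (P →ₗ[R] 𝒮.S i)

variable {A B C E M N P Q : Type u} [AddCommGroup A] [Module R A] [AddCommGroup B] [Module R B]
  [AddCommGroup C] [Module R C] [AddCommGroup E] [Module R E]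
  [AddCommGroup M] [Module R M] [AddCommGroup N] [Module R N]
  [AddCommGroup P] [Module R P] [AddCommGroup Q] [Module R Q]

theorem topRank_congr (e : P ≃ₗ[R] Q) : 𝒮.topRank P = 𝒮.topRank Q := by
  funext i
  let e' : (P →ₗ[R] 𝒮.S i) ≃ₗ[Module.End R (𝒮.S i)] (Q →ₗ[R] 𝒮.S i) :=
    { toFun := fun f ↦ f ∘ₗ e.symm.toLinearMap
      invFun := fun f ↦ f ∘ₗ e.toLinearMap
      left_inv := fun f ↦ by ext; simp
      right_inv := fun f ↦ by ext; simp
      map_add' := fun _ _ ↦ rfl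
      map_smul' := fun _ _ ↦ rfl }
  exact congrArg Nat.cast e'.finrank_eq

theorem topRank_of_subsingleton [Subsingleton P] : 𝒮.topRank P = 0 := by
  classical
  funext i
  have : Subsingleton (P →ₗ[R] 𝒮.S i) :=
    ⟨fun f g ↦ LinearMap.ext fun x ↦ by rw [Subsingleton.elim x 0, map_zero, map_zero]⟩
  have : Module.finrank (Module.End R (𝒮.S i)) (P →ₗ[R] 𝒮.S i) = 0 :=
    Module.finrank_zero_of_subsingleton
  simp [topRank, this]

theorem topRank_prod [∀ i, Module.Finite (Module.End R (𝒮.S i)) (𝒮.S i)] [Module.Finite R P] [Module.Finite R Q] :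
    𝒮.topRank (P × Q) = 𝒮.topRank P + 𝒮.topRank Q := by
  classical
  funext i
  have := finite_hom_simple (R := R) P (𝒮.S i)
  have := finite_hom_simple (R := R) Q (𝒮.S i)
  have h := (LinearMap.coprodEquiv (Module.End R (𝒮.S i)) (R := R) (M := P) (M₂ := Q)
    (M₃ := 𝒮.S i)).finrank_eq
  rw [Module.finrank_prod] at h
  simp [topRank, ← h]

/-- `M` has a resolution of length `n` by finitely generated projective modules in which the
alternating sum of the top ranks is `x`. -/
def HasEuler : ℕ → ∀ (M : Type u) [AddCommGroup M] [Module R M], (ι → ℚ) → Prop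
  | 0, M, _, _, x => Subsingleton M ∧ x = 0
  | n + 1, M, _, _, x => ∃ (K F : Type u) (_ : AddCommGroup K) (_ : Module R K)
      (_ : AddCommGroup F) (_ : Module R F) (i : K →ₗ[R] F) (p : F →ₗ[R] M) (y : ι → ℚ),
      Module.Projective R F ∧ Module.Finite R F ∧ IsSES i p ∧ HasEuler n K y ∧
      x = 𝒮.topRank F - y

variable {𝒮}

theorem HasEuler.congr {n : ℕ} {x : ι → ℚ} (h : 𝒮.HasEuler n M x) (e : M ≃ₗ[R] N) :
    𝒮.HasEuler n N x := by
  cases n with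
  | zero => exact ⟨have := h.1; e.symm.toEquiv.subsingleton, h.2⟩
  | succ n =>
    obtain ⟨K, F, _, _, _, _, i, p, y, hF, hfin, hip, hK, rfl⟩ := h
    exact ⟨K, F, _, _, _, _, i, _, y, hF, hfin, hip.equiv_comp e, hK, rfl⟩

theorem isSES_zero_id : IsSES (0 : PUnit.{u + 1} →ₗ[R] M) (LinearMap.id : M →ₗ[R] M) :=
  ⟨fun _ _ _ ↦ Subsingleton.elim _ _, Function.surjective_id,
    fun x ↦ ⟨fun h ↦ ⟨0, h.symm⟩, by rintro ⟨_, rfl⟩; rfl⟩⟩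

theorem hasEuler_of_projective [Module.Projective R P] [Module.Finite R P] :
    𝒮.HasEuler 1 P (𝒮.topRank P) :=
  ⟨PUnit, P, _, _, _, _, 0, LinearMap.id, 0, inferInstance, inferInstance, isSES_zero_id,
    ⟨inferInstance, rfl⟩, (sub_zero _).symm⟩

theorem HasEuler.succ {n : ℕ} {x : ι → ℚ} (h : 𝒮.HasEuler n M x) : 𝒮.HasEuler (n + 1) M x := by
  induction n generalizing M x with
  | zero =>
    obtain ⟨_, rfl⟩ := h
    have := hasEuler_of_projective (𝒮 := 𝒮) (P := M)
    rwa [topRank_of_subsingleton] at this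
  | succ n ih =>
    obtain ⟨K, F, _, _, _, _, i, p, y, hF, hfin, hip, hK, rfl⟩ := h
    exact ⟨K, F, _, _, _, _, i, p, y, hF, hfin, hip, ih hK, rfl⟩

theorem HasEuler.mono {m n : ℕ} {x : ι → ℚ} (h : 𝒮.HasEuler m M x) (hmn : m ≤ n) :
    𝒮.HasEuler n M x := by
  induction n, hmn using Nat.le_induction with
  | base => exact h
  | succ n _ ih => exact ih.succ

theorem exists_hasEuler [IsNoetherianRing R] {r : ℕ} [Module.Finite R M] (hM : PdLE R r M) :
    ∃ x, 𝒮.HasEuler (r + 1) M x := by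
  induction r generalizing M with
  | zero =>
    have := pdLE_zero_iff.1 hM
    exact ⟨_, hasEuler_of_projective⟩
  | succ r ih =>
    obtain ⟨n, p, hp⟩ := Module.Finite.exists_fin' R M
    have hs := isSES_ker hp
    obtain ⟨y, hy⟩ := ih (hs.pdLE_left (pdLE_of_projective r) hM)
    exact ⟨_, _, _, _, _, _, _, _, p, y, inferInstance, inferInstance, hs, hy, rfl⟩

variable [∀ i, Module.Finite (Module.End R (𝒮.S i)) (𝒮.S i)]

theorem HasEuler.of_isSES {α : A →ₗ[R] B} {β : B →ₗ[R] C} (h : IsSES α β) {n : ℕ} {x z : ι → ℚ}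
    (hA : 𝒮.HasEuler n A x) (hC : 𝒮.HasEuler n C z) : 𝒮.HasEuler n B (x + z) := by
  induction n generalizing A B C x z with
  | zero =>
    obtain ⟨_, rfl⟩ := hA
    obtain ⟨_, rfl⟩ := hC
    refine ⟨⟨fun b b' ↦ ?_⟩, add_zero 0⟩
    obtain ⟨a, ha⟩ := (h.exact (b - b')).1 (Subsingleton.elim _ _)
    rw [Subsingleton.elim a 0, map_zero] at ha
    exact (sub_eq_zero.1 ha.symm)
  | succ n ih =>
    obtain ⟨K, F, _, _, _, _, i, p, y, hF, hfin, hip, hK, rfl⟩ := hA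
    obtain ⟨K', F', _, _, _, _, i', p', y', hF', hfin', hip', hK', rfl⟩ := hC
    obtain ⟨π, φ, ψ, hπ, hφψ⟩ := h.horseshoe hip hip'
    refine ⟨LinearMap.ker π, F × F', _, _, _, _, _, π, y + y', inferInstance, inferInstance,
      isSES_ker hπ, ih hφψ hK hK', ?_⟩
    rw [topRank_prod]
    abel

/-- A resolution of a projective module splits. Independence of the resolution is needed only in
this case. -/
theorem HasEuler.eq_topRank {n : ℕ} {x : ι → ℚ} (h : 𝒮.HasEuler n M x) [Module.Projective R M] :
    x = 𝒮.topRank M := by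
  induction n generalizing M x with
  | zero =>
    obtain ⟨_, rfl⟩ := h
    rw [topRank_of_subsingleton]
  | succ n ih =>
    obtain ⟨K, F, _, _, _, _, i, p, y, hF, hfin, hip, hK, rfl⟩ := h
    obtain ⟨e⟩ := hip.nonempty_prodEquiv
    have : Module.Projective R K := pdLE_zero_iff.1 (PdLE.of_prodEquiv_left (pdLE_of_projective 0) e)
    have : Module.Finite R (K × M) := Module.Finite.equiv e.symm
    have : Module.Finite R K := Module.Finite.of_surjective (LinearMap.fst R K M)
      LinearMap.fst_surjective
    have : Module.Finite R M := Module.Finite.of_surjective p hip.surj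
    rw [ih hK, ← 𝒮.topRank_congr e, topRank_prod]
    abel

/-- The kernel of `F → M × P → M` is an extension of `P` by `K`. -/
theorem HasEuler.of_prod {n : ℕ} {z : ι → ℚ} [Module.Projective R P] [Module.Finite R P]
    (h : 𝒮.HasEuler n (M × P) z) : 𝒮.HasEuler (n + 1) M (z - 𝒮.topRank P) := by
  cases n with
  | zero =>
    obtain ⟨_, rfl⟩ := h
    have : Subsingleton M := (LinearMap.inl_injective (R := R) (M := M) (M₂ := P)).subsingleton
    have : Subsingleton P := (LinearMap.inr_injective (R := R) (M := M) (M₂ := P)).subsingleton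
    rw [topRank_of_subsingleton, sub_zero]
    exact succ ⟨inferInstance, rfl⟩
  | succ n =>
    obtain ⟨K, F, _, _, _, _, i, p, y, hF, hfin, hip, hK, rfl⟩ := h
    let p1 : F →ₗ[R] M := LinearMap.fst R M P ∘ₗ p
    have hp1 : Function.Surjective p1 := (LinearMap.fst_surjective (R := R)).comp hip.surj
    let φ : K →ₗ[R] LinearMap.ker p1 := i.codRestrict _ fun k ↦ by
      simp [p1, hip.apply_apply_eq_zero]
    let ψ : LinearMap.ker p1 →ₗ[R] P := LinearMap.snd R M P ∘ₗ p ∘ₗ (LinearMap.ker p1).subtype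
    have hs : IsSES φ ψ := by
      refine ⟨fun k k' hk ↦ hip.inj (congrArg Subtype.val hk), fun y ↦ ?_, fun x ↦ ⟨fun hx ↦ ?_, ?_⟩⟩
      · obtain ⟨x, hx⟩ := hip.surj (0, y)
        exact ⟨⟨x, by simp [p1, hx]⟩, by simp [ψ, hx]⟩
      · obtain ⟨k, hk⟩ := (hip.exact (x : F)).1 (Prod.ext x.2 hx)
        exact ⟨k, Subtype.ext hk⟩
      · rintro ⟨k, rfl⟩
        exact congrArg Prod.snd (hip.apply_apply_eq_zero k)
    refine ⟨LinearMap.ker p1, F, _, _, _, _, _, p1, y + 𝒮.topRank P, hF, hfin, isSES_ker hp1,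
      of_isSES hs hK.succ (hasEuler_of_projective.mono (by omega)), by abel⟩

/-- For `P → N` the first step of a resolution of `N`, the pullback of `E → N ← P` is an extension
of `E` by `K` and of `P` by `M`. The latter splits, and `of_prod` cancels `P`. -/
theorem HasEuler.left_of_isSES {f : M →ₗ[R] E} {g : E →ₗ[R] N} (h : IsSES f g) {m n : ℕ}
    {x y : ι → ℚ} (hE : 𝒮.HasEuler m E x) (hN : 𝒮.HasEuler n N y) :
    ∃ r, 𝒮.HasEuler r M (x - y) := by
  cases n with
  | zero =>
    obtain ⟨_, rfl⟩ := hN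
    have hf : Function.Surjective f := fun e ↦ (h.exact e).1 (Subsingleton.elim _ _)
    exact ⟨m, by simpa using hE.congr (LinearEquiv.ofBijective f ⟨h.inj, hf⟩).symm⟩
  | succ n =>
    obtain ⟨K, P, _, _, _, _, i, p, y, hP, hfin, hip, hK, rfl⟩ := hN
    let π : E × P →ₗ[R] N := g.coprod (-p)
    have hπ (z) : z ∈ LinearMap.ker π ↔ g z.1 = p z.2 := by
      simp [π, add_neg_eq_zero]
    let a : K →ₗ[R] LinearMap.ker π := (LinearMap.inr R E P ∘ₗ i).codRestrict _ fun k ↦ by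
      simp [hπ, hip.apply_apply_eq_zero]
    let b : LinearMap.ker π →ₗ[R] E := LinearMap.fst R E P ∘ₗ (LinearMap.ker π).subtype
    have hab : IsSES a b := by
      refine ⟨fun k k' hk ↦ hip.inj ?_, fun e ↦ ?_, fun z ↦ ⟨fun hz ↦ ?_, ?_⟩⟩
      · exact congrArg (fun z : LinearMap.ker π ↦ (z : E × P).2) hk
      · obtain ⟨q, hq⟩ := hip.surj (g e)
        exact ⟨⟨(e, q), (hπ _).2 hq.symm⟩, rfl⟩
      · have hz' : (z : E × P).1 = 0 := hz
        have hz2 := (hπ _).1 z.2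
        rw [hz', map_zero] at hz2
        obtain ⟨k, hk⟩ := (hip.exact _).1 hz2.symm
        exact ⟨k, Subtype.ext (Prod.ext hz'.symm hk)⟩
      · rintro ⟨k, rfl⟩
        rfl
    let c : M →ₗ[R] LinearMap.ker π := (LinearMap.inl R E P ∘ₗ f).codRestrict _ fun k ↦ by
      simp [hπ, h.apply_apply_eq_zero]
    let d : LinearMap.ker π →ₗ[R] P := LinearMap.snd R E P ∘ₗ (LinearMap.ker π).subtype
    have hcd : IsSES c d := by
      refine ⟨fun k k' hk ↦ h.inj ?_, fun q ↦ ?_, fun z ↦ ⟨fun hz ↦ ?_, ?_⟩⟩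
      · exact congrArg (fun z : LinearMap.ker π ↦ (z : E × P).1) hk
      · obtain ⟨e, he⟩ := h.surj (p q)
        exact ⟨⟨(e, q), (hπ _).2 he⟩, rfl⟩
      · have hz' : (z : E × P).2 = 0 := hz
        have hz2 := (hπ _).1 z.2
        rw [hz', map_zero] at hz2
        obtain ⟨k, hk⟩ := (h.exact _).1 hz2
        exact ⟨k, Subtype.ext (Prod.ext hk hz'.symm)⟩
      · rintro ⟨k, rfl⟩
        rfl
    obtain ⟨e⟩ := hcd.nonempty_prodEquiv
    have hZ := of_isSES hab (hK.mono (le_max_right m n)) (hE.mono (le_max_left m n))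
    refine ⟨max m n + 1, ?_⟩
    have := (hZ.congr e.symm).of_prod
    rwa [show y + x - 𝒮.topRank P = x - (𝒮.topRank P - y) by abel] at this

end SimpleFamily

end Euler

/-! ### Finite global dimension -/

section Counting

variable {R : Type u} [Ring R] {ι : Type} (𝒮 : SimpleFamily R ι)

theorem finite_envelope (k : Type v) [CommRing k] [IsArtinianRing k] [Algebra k R]
    [Module.Finite k R] [IsSemiprimaryRing R] (M : ModuleCat.{u} R) [Module.Finite R M] :
    Module.Finite R (envelope M) :=
  (isEssential_range_toEnvelope M).finite k
    (Module.Finite.iff_fg.1 (Module.Finite.range (toEnvelope M)))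

/-- Finitely generated injective modules are built from envelopes of simple modules. -/
theorem SimpleFamily.injective_induction [IsArtinianRing R] [IsNoetherianRing R]
    {motive : ∀ (E : Type u) [AddCommGroup E] [Module R E], Prop}
    (zero : ∀ (E : Type u) [AddCommGroup E] [Module R E] [Subsingleton E], motive E)
    (step : ∀ (i : ι) (E E' : Type u) [AddCommGroup E] [Module R E] [AddCommGroup E']
      [Module R E'] (j : envelope (𝒮.S i) →ₗ[R] E) (q : E →ₗ[R] E'), IsSES j q → motive E' →
      motive E)
    (E : Type u) [AddCommGroup E] [Module R E] [Module.Finite R E] (hE : Module.Injective R E) :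
    motive E := by
  suffices h : ∀ (n : ℕ) (E : Type u) [AddCommGroup E] [Module R E] [Module.Finite R E],
      Module.Injective R E → Module.length R E ≤ n → motive E by
    obtain ⟨n, hn⟩ := ENat.ne_top_iff_exists.1 (Module.length_ne_top (R := R) (M := E))
    exact h n E hE hn.ge
  intro n
  induction n with
  | zero =>
    intro E _ _ _ _ hn
    have : Subsingleton E := Module.length_eq_zero_iff.1 (le_antisymm (by simpa using hn) bot_le)
    exact zero E
  | succ n ih =>
    intro E _ _ _ hE hn
    rcases subsingleton_or_nontrivial E with hs | hs
    · exact zero E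
    obtain ⟨a, ha⟩ := IsAtomic.exists_atom (Submodule R E)
    have := isSimpleModule_iff_isAtom.2 ha
    obtain ⟨i, ⟨e⟩⟩ := 𝒮.exists_equiv a
    let f : 𝒮.S i →ₗ[R] E := a.subtype ∘ₗ e.toLinearMap
    have hf : Function.Injective f := a.injective_subtype.comp e.injective
    -- The envelope of a simple submodule embeds by essentiality and splits off, leaving an
    -- injective module of smaller length.
    obtain ⟨j, hj'⟩ := exists_extension_of_injective hE (toEnvelope_injective (𝒮.S i)) f
    have hj : Function.Injective j := (isEssential_range_toEnvelope (𝒮.S i)).injective j (by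
      rintro _ ⟨x, rfl⟩ hx
      have : x = 0 := hf (by rw [← hj', LinearMap.comp_apply, hx, map_zero])
      rw [this, map_zero])
    have hs := isSES_range hj
    obtain ⟨e'⟩ := hs.nonempty_prodEquiv_of_injective (injective_envelope _)
    refine step i E _ j _ hs (ih _ (injective_of_prodEquiv_right hE e') ?_)
    have h1 := Module.length_eq_add_of_exact j _ hs.inj hs.surj hs.exact
    have : Nontrivial (envelope (𝒮.S i)) :=
      have := IsSimpleModule.nontrivial R (𝒮.S i)
      (toEnvelope_injective (𝒮.S i)).nontrivial
    have h2 : 1 ≤ Module.length R (envelope (𝒮.S i)) :=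
      Order.one_le_iff_pos.2 Module.length_pos
    rw [h1] at hn
    have h3 := (add_le_add_left h2 _).trans hn
    rw [Nat.cast_add, Nat.cast_one, add_comm (n : ℕ∞)] at h3
    exact (ENat.add_le_add_iff_left ENat.one_ne_top).1 h3

theorem pdLE_of_injective_of_coresLE {E : Type u} [AddCommGroup E] [Module R E] {s : ℕ}
    (hE : Module.Injective R E) (h : CoresLE R 1 s E) : PdLE R s E :=
  (h.envelope (N := PUnit.{u + 1}) (ι := LinearMap.id) (q := 0) hE
    ⟨Function.injective_id, fun x ↦ ⟨0, Subsingleton.elim _ _⟩,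
      fun x ↦ ⟨fun _ ↦ ⟨x, rfl⟩, fun _ ↦ rfl⟩⟩
    (fun L hL ↦ by simpa using hL)).1

theorem idLE_of_projective {d : ℕ} (hd : IdLE R d R) (P : Type u) [AddCommGroup P] [Module R P]
    [Module.Projective R P] [Module.Finite R P] : IdLE R d P := by
  obtain ⟨n, p, hp⟩ := Module.Finite.exists_fin' R P
  let p' : (ULift.{u} (Fin n) → R) →ₗ[R] P :=
    p ∘ₗ (LinearEquiv.funCongrLeft R R Equiv.ulift.symm).toLinearMap
  have hp' : Function.Surjective p' := hp.comp (LinearEquiv.surjective _)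
  obtain ⟨s, hs⟩ := Module.projective_lifting_property p' LinearMap.id hp'
  exact IdLE.retract (IdLE.pi fun _ ↦ hd) s p' hs

/-- `V` is spanned by the Euler vectors of the envelopes of finite projective dimension. A finitely
generated projective has finite injective dimension, and its minimal coresolution consists of
finitely generated injectives of finite projective dimension, so its top rank lies in `V`. Hence `V`
is all of `ℚ^ι`, which fewer than `|ι|` vectors cannot span. -/
theorem SimpleFamily.exists_pdLE_envelope (k : Type v) [CommRing k] [IsArtinianRing k]
    [Algebra k R] [Module.Finite k R] [IsArtinianRing R] [IsNoetherianRing R] [Finite ι]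
    (hR : ∀ n, CoresLE R n 0 R) {d : ℕ} (hd : IdLE R d R) (i : ι) :
    ∃ r, PdLE R r (envelope (𝒮.S i)) := by
  classical
  have := Fintype.ofFinite ι
  have hfin (i : ι) : Module.Finite (Module.End R (𝒮.S i)) (𝒮.S i) := finite_end k _
  have hfinE (i : ι) : Module.Finite R (envelope (𝒮.S i)) := finite_envelope k _
  let I := {i : ι // ∃ r, PdLE R r (envelope (𝒮.S i))}
  have hI (i : I) : ∃ (x : ι → ℚ) (n : ℕ), 𝒮.HasEuler n (envelope (𝒮.S i)) x := by
    obtain ⟨r, hr⟩ := i.2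
    obtain ⟨x, hx⟩ := exists_hasEuler (𝒮 := 𝒮) hr
    exact ⟨x, _, hx⟩
  choose x n hx using hI
  let V := Submodule.span ℚ (Set.range x)
  have hinj (E : Type u) [AddCommGroup E] [Module R E] [Module.Finite R E]
      (hE : Module.Injective R E) : ∀ s, PdLE R s E → ∃ y ∈ V, ∃ m, 𝒮.HasEuler m E y := by
    refine 𝒮.injective_induction (motive := fun E _ _ ↦ ∀ s, PdLE R s E →
      ∃ y ∈ V, ∃ m, 𝒮.HasEuler m E y) ?_ ?_ E hE
    · exact fun E _ _ _ s _ ↦ ⟨0, V.zero_mem, 0, inferInstance, rfl⟩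
    · intro i E E' _ _ _ _ j q hjq ih s hs
      obtain ⟨e⟩ := hjq.nonempty_prodEquiv_of_injective (injective_envelope _)
      obtain ⟨y, hy, m, hm⟩ := ih s (hs.of_prodEquiv_right e)
      let i' : I := ⟨i, s, hs.of_prodEquiv_left e⟩
      exact ⟨x i' + y, V.add_mem (Submodule.subset_span ⟨i', rfl⟩) hy, max (n i') m,
        .of_isSES hjq ((hx i').mono (le_max_left _ _)) (hm.mono (le_max_right _ _))⟩
  -- The Euler vector of `N` is taken as that of its envelope minus that of its cosyzygy, whose
  -- injective dimension is smaller.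
  have hid (d : ℕ) : ∀ (s : ℕ) (N : Type u) [AddCommGroup N] [Module R N] [Module.Finite R N],
      IdLE R d N → (∀ n, CoresLE R n s N) → ∃ y ∈ V, ∃ m, 𝒮.HasEuler m N y := by
    induction d with
    | zero =>
      intro s N _ _ _ hN hc
      have hN' := idLE_zero_iff.1 hN
      exact hinj N hN' s (pdLE_of_injective_of_coresLE hN' (hc 1))
    | succ d ih =>
      intro s N _ _ _ hN hc
      have := finite_envelope k (ModuleCat.of R N)
      have hE := injective_envelope (ModuleCat.of R N)
      have hs := isSES_range (toEnvelope_injective (ModuleCat.of R N))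
      have henv n := (hc (n + 1)).envelope hE hs (isEssential_range_toEnvelope _)
      obtain ⟨y, hy, m, hm⟩ := hinj _ hE s (henv 0).1
      obtain ⟨y', hy', m', hm'⟩ := ih (s + 1) _ (hs.idLE_right hN (idLE_of_injective hE d))
        fun n ↦ (henv n).2
      obtain ⟨r, hr⟩ := hm.left_of_isSES hs hm'
      exact ⟨y - y', V.sub_mem hy hy', r, hr⟩
  have hV : V = ⊤ := by
    have hsingle (i : ι) : Pi.single i (1 : ℚ) ∈ V := by
      obtain ⟨P, _, _, hP, hPfin, h0, f, hf⟩ := 𝒮.exists_projective i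
      obtain ⟨y, hy, m, hm⟩ := hid d 0 P (idLE_of_projective hd P)
        fun n ↦ CoresLE.of_projective hR n
      rw [hm.eq_topRank] at hy
      have := finite_hom_simple (R := R) P (𝒮.S i)
      have : Nontrivial (P →ₗ[R] 𝒮.S i) := ⟨f, 0, hf⟩
      have hpos : 0 < Module.finrank (Module.End R (𝒮.S i)) (P →ₗ[R] 𝒮.S i) :=
        Module.finrank_pos
      have hrank : 𝒮.topRank P = 𝒮.topRank P i • Pi.single i (1 : ℚ) := by
        funext j
        rcases eq_or_ne j i with rfl | hj
        · simp
        · have : Subsingleton (P →ₗ[R] 𝒮.S j) := ⟨fun f g ↦ by rw [h0 j hj f, h0 j hj g]⟩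
          have : Module.finrank (Module.End R (𝒮.S j)) (P →ₗ[R] 𝒮.S j) = 0 :=
            Module.finrank_zero_of_subsingleton
          simp [hj, SimpleFamily.topRank, this]
      have hne : 𝒮.topRank P i ≠ 0 := Nat.cast_ne_zero.2 hpos.ne'
      rw [hrank] at hy
      exact (V.smul_mem_iff hne).1 hy
    rw [eq_top_iff]
    intro y _
    rw [pi_eq_sum_univ' y]
    exact V.sum_mem fun i _ ↦ V.smul_mem _ (hsingle i)
  by_contra hi
  have hcard : Fintype.card I < Fintype.card ι := Fintype.card_subtype_lt hi
  have h1 : Module.finrank ℚ V ≤ Fintype.card I := finrank_range_le_card x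
  rw [hV, finrank_top, Module.finrank_fintype_fun_eq_card] at h1
  omega

/-- Dimension shifting: the kernel of a free cover satisfies the coresolution condition with `s`
lowered by one, until `h3` applies at zero. -/
theorem pdLE_of_forall_coresLE [IsNoetherianRing R] (hR : ∀ n, CoresLE R n 0 R)
    (h3 : ∀ (L : Type u) [AddCommGroup L] [Module R L] [Module.Finite R L],
      (∀ n, CoresLE R n 0 L) → Module.Projective R L) (s : ℕ) (M : Type u) [AddCommGroup M]
    [Module R M] [Module.Finite R M] (hM : ∀ n, CoresLE R n s M) : PdLE R s M := by
  induction s generalizing M with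
  | zero => exact pdLE_zero_iff.2 (h3 M hM)
  | succ s ih =>
    obtain ⟨n, p, hp⟩ := Module.Finite.exists_fin' R M
    have hs := isSES_ker hp
    refine hs.pdLE_right (ih _ fun n ↦ ?_) (pdLE_of_projective _)
    cases n with
    | zero => trivial
    | succ n =>
      exact CoresLE.left_of_isSES hs ((CoresLE.of_projective hR _).mono (Nat.zero_le s)) (hM n)

/-- The global dimension of a semiprimary ring is the projective dimension of `R ⧸ J`. -/
theorem pdLE_of_pdLE_quotient_jacobson [IsSemiprimaryRing R] {D : ℕ}
    (hD : PdLE R D (R ⧸ Ring.jacobson R)) (M : Type u) [AddCommGroup M] [Module R M] :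
    PdLE R D M := by
  -- The radical filtration reduces to modules killed by `J`, which are summands of direct sums of
  -- copies of `R/J`.
  refine IsSemiprimaryRing.induction R R M (P := fun M ↦ PdLE R D M)
    (fun M _ _ _ _ _ hJ ↦ ?_) (fun M _ _ _ _ hs hq ↦ (isSES_mkQ _).pdLE_middle hs hq)
  have : IsSemisimpleModule R (R ⧸ Ring.jacobson R) := isSemisimpleModule_of_jacobson_smul <|
    (Module.isTorsionBySet_quotient_iff _ _).2 fun m i hi ↦ Ideal.mul_mem_right _ _ hi
  let f : (M →₀ R ⧸ Ring.jacobson R) →ₗ[R] M := Finsupp.lsum ℕ fun m ↦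
    (Ring.jacobson R).liftQ (LinearMap.toSpanSingleton R M m) fun r hr ↦ @hJ m ⟨r, hr⟩
  have hf : Function.Surjective f := fun m ↦
    ⟨Finsupp.single m (Submodule.Quotient.mk 1),
      (Finsupp.lsum_single ..).trans (one_smul R m)⟩
  obtain ⟨i, hi⟩ := IsSemisimpleModule.lifting_property f hf LinearMap.id
  exact (hD.finsupp M).retract i f hi

end Counting

/-! ### Auslander-regular Artin algebras -/

section Equivalence

variable {R : Type u} [Ring R]

theorem projDimLEClass_iff (s : ℕ) (M : ModuleCat.{u} R) :
    projDimLEClass R s M ↔ PdLE R s M :=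
  projectiveDimension_le_iff M s

theorem projDimLEClass_self (s : ℕ) : projDimLEClass R s (ModuleCat.of R R) :=
  (projDimLEClass_iff s _).2 (pdLE_of_projective s)

theorem globalDimension_lt_top_iff :
    globalDimension R < ⊤ ↔
      ∃ g : ℕ, ∀ (X : Type u) [AddCommGroup X] [Module R X], PdLE R g X := by
  constructor
  · intro h
    have : ∃ g : ℕ, globalDimension R ≤ g := by
      induction hd : globalDimension R with
      | bot => exact ⟨0, bot_le⟩
      | coe a =>
        rw [hd] at h
        obtain ⟨g, rfl⟩ := ENat.ne_top_iff_exists.1 (WithBot.coe_lt_coe.1 h).ne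
        exact ⟨g, le_rfl⟩
    obtain ⟨g, hg⟩ := this
    exact ⟨g, fun X _ _ ↦ (projectiveDimension_le_iff (ModuleCat.of R X) g).1
      ((le_iSup (fun M : ModuleCat.{u} R ↦ projectiveDimension M) _).trans hg)⟩
  · rintro ⟨g, hg⟩
    have h : globalDimension R ≤ g :=
      iSup_le fun M ↦ (projectiveDimension_le_iff M g).2 (hg M)
    exact h.trans_lt (WithBot.coe_lt_coe.2 (ENat.natCast_lt_top g))

/-- Envelopes and cosyzygies stay finitely generated over an Artin algebra, so the uniform bound `D`
applies at every stage. -/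
theorem coresLE_of_pdLE_injective (k : Type v) [CommRing k] [IsArtinianRing k] [Algebra k R]
    [Module.Finite k R] [IsSemiprimaryRing R] {D : ℕ}
    (hD : ∀ (E : Type u) [AddCommGroup E] [Module R E] [Module.Finite R E],
      Module.Injective R E → PdLE R D E) (n : ℕ) {s : ℕ} (hs : D ≤ s) (M : Type u)
    [AddCommGroup M] [Module R M] [Module.Finite R M] : CoresLE R n s M := by
  induction n generalizing s M with
  | zero => trivial
  | succ n ih =>
    have := finite_envelope k (ModuleCat.of R M)
    have hE := injective_envelope (ModuleCat.of R M)
    exact ⟨_, _, _, _, _, _, _, _, hE, (hD _ hE).mono hs,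
      isSES_range (toEnvelope_injective (ModuleCat.of R M)), ih (hs.trans s.le_succ) _⟩

/-- The bound is the largest projective dimension of an envelope of a simple module. It bounds all
finitely generated injectives, hence by `h3` the projective dimension of `R/J`. -/
theorem exists_forall_pdLE (k : Type v) [CommRing k] [IsArtinianRing k] [Algebra k R]
    [Module.Finite k R]
    [IsArtinianRing R] [IsNoetherianRing R] [IsNoetherianRing Rᵐᵒᵖ]
    (hR : ∀ n, CoresLE R n 0 R)
    (h3 : ∀ (L : Type u) [AddCommGroup L] [Module R L] [Module.Finite R L],
      (∀ n, CoresLE R n 0 L) → Module.Projective R L) :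
    ∃ D : ℕ, ∀ (X : Type u) [AddCommGroup X] [Module R X], PdLE R D X := by
  obtain ⟨d, hd⟩ := exists_idLE_self hR h3
  obtain ⟨ι, _, ⟨𝒮⟩⟩ := exists_simpleFamily R
  have := Fintype.ofFinite ι
  choose r hr using 𝒮.exists_pdLE_envelope k hR hd
  have hD (E : Type u) [AddCommGroup E] [Module R E] [Module.Finite R E]
      (hE : Module.Injective R E) : PdLE R (Finset.univ.sup r) E :=
    𝒮.injective_induction (motive := fun E _ _ ↦ PdLE R (Finset.univ.sup r) E)
      (fun E _ _ _ ↦ pdLE_of_subsingleton _)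
      (fun i E E' _ _ _ _ j q hjq ih ↦
        hjq.pdLE_middle ((hr i).mono (Finset.le_sup (Finset.mem_univ i))) ih) E hE
  exact ⟨_, fun X _ _ ↦ pdLE_of_pdLE_quotient_jacobson (pdLE_of_forall_coresLE hR h3 _ _
    fun n ↦ coresLE_of_pdLE_injective k hD n le_rfl _) X⟩

theorem IsAuslanderRegular.gInftyClass_eq [IsSemiprimaryRing R] (h : IsAuslanderRegular R)
    (s : ℕ) : gInftyClass R s = projDimLEClass R s := by
  have := h.noetherian_left
  obtain ⟨g, hg⟩ := globalDimension_lt_top_iff.1 h.gldim_lt_top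
  have hR : ∀ n, CoresLE R n 0 R := (gInftyClass_iff 0 (ModuleCat.of R R)).1 h.auslander
  ext M
  rw [gInftyClass_iff, projDimLEClass_iff]
  exact ⟨fun hM ↦ (hM g).pdLE hg (Nat.le_add_left g s), fun hM n ↦ CoresLE.of_pdLE hR hM n⟩

theorem isAuslanderRegular_of_gInftyClass_inf_isFG_eq (k : Type v) [CommRing k] [IsArtinianRing k]
    [Algebra k R] [Module.Finite k R]
    (h : gInftyClass R 0 ⊓ ModuleCat.isFG R = projDimLEClass R 0 ⊓ ModuleCat.isFG R) :
    IsAuslanderRegular R := by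
  have hmem (M : ModuleCat.{u} R) [Module.Finite R M] :
      gInftyClass R 0 M ↔ projDimLEClass R 0 M := by
    have hM : ModuleCat.isFG R M := ‹Module.Finite R M›
    simpa [hM] using iff_of_eq (congrFun h M)
  have : IsArtinianRing R := .of_finite k R
  have : IsNoetherianRing R := .of_finite k R
  have : Module.Finite k Rᵐᵒᵖ := .equiv (MulOpposite.opLinearEquiv k)
  have : IsNoetherianRing Rᵐᵒᵖ := .of_finite k Rᵐᵒᵖ
  have hR := (hmem (ModuleCat.of R R)).2 (projDimLEClass_self 0)
  refine ⟨inferInstance, inferInstance, hR, globalDimension_lt_top_iff.2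
    (exists_forall_pdLE k ((gInftyClass_iff 0 (ModuleCat.of R R)).1 hR) fun L _ _ _ hL ↦ ?_)⟩
  exact pdLE_zero_iff.1 ((projDimLEClass_iff 0 (ModuleCat.of R L)).1
    ((hmem (ModuleCat.of R L)).1 ((gInftyClass_iff 0 (ModuleCat.of R L)).2 hL)))

end Equivalence

end AuslanderType

theorem theorem6p9 (k : Type v) [CommRing k] [IsArtinianRing k]
    (R : Type u) [Ring R] [Algebra k R] [Module.Finite k R] :
    List.TFAE [
      AuslanderType.IsAuslanderRegular R,
      AuslanderType.gInftyClass R 0 = AuslanderType.projDimLEClass R 0,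
      AuslanderType.gInftyClass R 0 ⊓ ModuleCat.isFG R =
        AuslanderType.projDimLEClass R 0 ⊓ ModuleCat.isFG R,
      ∀ s : ℕ, AuslanderType.gInftyClass R s = AuslanderType.projDimLEClass R s,
      ∀ s : ℕ, AuslanderType.gInftyClass R s ⊓ ModuleCat.isFG R =
        AuslanderType.projDimLEClass R s ⊓ ModuleCat.isFG R] := by
  have : IsArtinianRing R := .of_finite k R
  tfae_have 1 → 4 := fun h ↦ h.gInftyClass_eq
  tfae_have 4 → 5 := fun h s ↦ by rw [h s]
  tfae_have 4 → 2 := fun h ↦ h 0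
  tfae_have 2 → 3 := fun h ↦ by rw [h]
  tfae_have 5 → 3 := fun h ↦ h 0
  tfae_have 3 → 1 := AuslanderType.isAuslanderRegular_of_gInftyClass_inf_isFG_eq k
  tfae_finish
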